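/- Let $(K,v)$ be an algebraically closed, non-trivially valued field of characteristic $0$ with value group $\Gamma_K$, written additively, and let $\mathcal{M}_K$ be the maximal ideal of its valuation ring. Let $\mathcal{L}$ be a first-order language extending the language $\mathcal{L}_{div}=(+,-,\cdot,0,1,\mathrm{div})$, where $\mathrm{div}(x,y)$ means $v(x)\le v(y)$, and let $(K,\mathcal{L})$ be an expansion of $(K,\mathcal{L}_{div})$. Definable means $\mathcal{L}$-definable with parameters; a function $\Gamma_K\to\Gamma_K$ is called definable if the pullback of its graph under $v$ to $K^\times\times K^\times$ is definable. Closed balls are the sets $\{x: v(x-a)\ge\gamma\}$ with $\gamma\in\Gamma_K\cup\{+\infty\}$, open balls are the sets $\{x: v(x-a)>\gamma\}$ with $\gamma\in\Gamma_K\cup\{-\infty\}$. Assume that: 1. $(K,\mathcal{L})$ is $C$-minimal: for every $\mathcal{L}$-structure $K'$ elementarily equivalent to $(K,\mathcal{L})$, every definable subset of $K'$ is a Boolean combination of balls; 2. $(K,\mathcal{L})$ is definably complete: every definable family of nested balls whose set of radii tends to $+\infty$ has non-empty intersection; 3. every definable function $g\colon\Gamma_K\to\Gamma_K$ is eventually $\mathbb{Q}$-linear: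 there are $r\in\mathbb{Q}$ and $\alpha,\delta\in\Gamma_K$ such that $g(\gamma)=r\gamma+\alpha$ for all $\gamma>\delta$. Let $W\subseteq K^n$ be a definable set, let $X\subseteq W\times K$ be a definable set that projects onto $W$, and let $f\colon X\to K$ be a definable function. For $Y\subseteq X$ and $w\in W$ write $Y_w=\{x\in K:(w,x)\in Y\}$, and write $f_w\colon X_w\to K$ for the function $f_w(x)=f(w,x)$. Then $X$ is the union of pairwise disjoint definable sets $F$, $E$ and $J$ such that for every $w\in W$: 1. $F_w$ is finite; 2. $f_w|_{E_w}$ is locally constant: every $x\in E_w$ lies in an open ball $B\subseteq E_w$ on which $f_w$ is constant; 3. $f_w|_{J_w}$ has locally the Jacobian property: every $x\in J_w$ lies in an open ball $B\subseteq J_w$ such that $f_w|_B$ has the Jacobian property. Here a function $g\colon B\to K$ on an open ball $B$ has the Jacobian property if (i) $g$ is injective and $g(B)$ is an open ball; (ii) $g$ is differentiable on $B$ and $g'$ does not vanish; (iii) $\mathrm{rv}(g'(x))$ is constant on $B$, say equal to $c$; (iv) $\mathrm{rv}(g(x)-g(y))=\mathrm{rv}(x-y)\,c$ for all $x,y\in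 B$. The map $\mathrm{rv}\colon K\to \mathrm{RV}=K^\times/(1+\mathcal{M}_K)\cup\{0\}$ is the quotient map on $K^\times$ and sends $0$ to $0$. -/

import Mathlib

open FirstOrder

/-! ### The language of valued fields and its expansions -/

/-- The only relation symbol of the language of valued fields: the binary symbol `div`. -/
inductive DivRel : ℕ → Type
  | div : DivRel 2

/-- The language `(+, -, ·, 0, 1, div)` of valued fields. -/
def divLang : FirstOrder.Language where
  Functions := ringFunc
  Relations := DivRel

/-- A valued field as a structure for `divLang`: the ring operations have their usual meaning and
`div(x, y)` means `v x ≤ v y`. -/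
@[reducible] def divStructure {K Γ : Type*} [Field K] [AddCommGroup Γ] [LinearOrder Γ]
    [IsOrderedAddMonoid Γ] (v : AddValuation K (WithTop Γ)) : divLang.Structure K where
  funMap := fun f x => match f with
    | .add => x 0 + x 1
    | .mul => x 0 * x 1
    | .neg => - x 0
    | .zero => 0
    | .one => 1
  RelMap := fun r x => match r with
    | .div => v (x 0) ≤ v (x 1)

section Balls

variable {K Γ : Type*} [Field K] [AddCommGroup Γ] [LinearOrder Γ] [IsOrderedAddMonoid Γ]

/-- The closed ball of radius `γ ∈ Γ ∪ {+∞}`; it is a point for `γ = +∞`. -/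
def vClosedBall (v : AddValuation K (WithTop Γ)) (a : K) (γ : WithTop Γ) : Set K :=
  {x | γ ≤ v (x - a)}

/-- The open ball of radius `γ ∈ Γ`. -/
def vOpenBall (v : AddValuation K (WithTop Γ)) (a : K) (γ : Γ) : Set K :=
  {x | (γ : WithTop Γ) < v (x - a)}

/-- Open balls have radius in `Γ ∪ {-∞}`, so the whole field is one of them. -/
def IsOpenVBall (v : AddValuation K (WithTop Γ)) (B : Set K) : Prop :=
  B = Set.univ ∨ ∃ (a : K) (γ : Γ), B = vOpenBall v a γ

/-- `B` is a ball, closed or open, of radius `ρ ∈ Γ ∪ {+∞}`. -/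
def IsVBallOfRadius (v : AddValuation K (WithTop Γ)) (B : Set K) (ρ : WithTop Γ) : Prop :=
  ∃ a : K, B = vClosedBall v a ρ ∨ ∃ γ : Γ, ρ = γ ∧ B = vOpenBall v a γ

/-- A ball is a closed or an open ball. -/
def IsVBall (v : AddValuation K (WithTop Γ)) (B : Set K) : Prop :=
  IsOpenVBall v B ∨ ∃ (a : K) (γ : WithTop Γ), B = vClosedBall v a γ

end Balls

/-! ### `C`-minimality -/

section CMinimality

universe u₁ u₂ u₃

variable {L : FirstOrder.Language.{u₁, u₂}} (ι : divLang →ᴸ L)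

/-- The interpretation of `x - y` in an arbitrary `L`-structure. -/
def langSub {M : Type*} [L.Structure M] (x y : M) : M :=
  FirstOrder.Language.Structure.funMap (ι.onFunction (n := 2) ringFunc.add)
    ![x, FirstOrder.Language.Structure.funMap (ι.onFunction (n := 1) ringFunc.neg) ![y] ]

/-- The interpretation of `0` in an arbitrary `L`-structure. -/
def langZero (M : Type*) [L.Structure M] : M :=
  FirstOrder.Language.Structure.funMap (ι.onFunction (n := 0) ringFunc.zero) ![]

/-- The interpretation of `div`, that is of `v x ≤ v y`, in an arbitrary `L`-structure. -/
def langDiv {M : Type*} [L.Structure M] (x y : M) : Prop :=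
  FirstOrder.Language.Structure.RelMap (ι.onRelation (n := 2) DivRel.div) ![x, y]

/-- Balls of an `L`-structure elementarily equivalent to a valued field, described by `div`; the
radius is the value of `b`. They are the whole structure, the sets `{x | v (x - a) ≥ v b}`, where
`b = 0` gives the points, and the sets `{x | v (x - a) > v b}` with `b ≠ 0`. -/
def IsLangBall {M : Type*} [L.Structure M] (B : Set M) : Prop :=
  B = Set.univ ∨ ∃ a b : M, B = {x | langDiv ι b (langSub ι x a)} ∨
    (b ≠ langZero ι M ∧ B = {x | ¬ langDiv ι (langSub ι x a) b})

/-- `C`-minimality: in every structure elementarily equivalent to `K`, every subset of the universe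
that is definable with parameters is a Boolean combination of balls. -/
def IsCMinimal (K : Type u₃) [L.Structure K] : Prop :=
  ∀ (M : Type (max u₁ u₂ u₃)) [L.Structure M], L.ElementarilyEquivalent K M →
    ∀ S : Set M, (Set.univ : Set M).Definable₁ L S →
      S ∈ BooleanSubalgebra.closure {B : Set M | IsLangBall ι B}

end CMinimality

/-! ### Definable families -/

section Families

variable (L : FirstOrder.Language) {K : Type*} [L.Structure K] {n : ℕ}

/-- `X ⊆ K ^ n × K` is definable (with parameters). -/
def DefinableFam (X : Set ((Fin n → K) × K)) : Prop :=
  (Set.univ : Set K).Definable L {z : Fin n ⊕ Fin 1 → K | (z ∘ Sum.inl, z (Sum.inr 0)) ∈ X}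

/-- The fibre `X_w`. -/
def fibre (X : Set ((Fin n → K) × K)) (w : Fin n → K) : Set K := {x | (w, x) ∈ X}

/-- `X ⊆ W × K` is a definable family of subsets of `K` parametrized by the definable set `W`. -/
structure IsDefinableFamily (W : Set (Fin n → K)) (X : Set ((Fin n → K) × K)) : Prop where
  definable_base : (Set.univ : Set K).Definable L W
  definable_total : DefinableFam L X
  image_fst : Prod.fst '' X = W

/-- `f`, restricted to `X ⊆ K ^ n × K`, is definable: its graph over `X` is definable. -/
def DefinableFunOn (X : Set ((Fin n → K) × K)) (f : (Fin n → K) → K → K) : Prop :=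
  (Set.univ : Set K).Definable L {z : Fin n ⊕ Fin 2 → K |
    (z ∘ Sum.inl, z (Sum.inr 0)) ∈ X ∧ f (z ∘ Sum.inl) (z (Sum.inr 0)) = z (Sum.inr 1)}

end Families

/-! ### Definable completeness and definable functions of the value group -/

section Hypotheses

variable (L : FirstOrder.Language) {K Γ : Type*} [L.Structure K] [Field K] [AddCommGroup Γ] [LinearOrder Γ]
  [IsOrderedAddMonoid Γ]

/-- Every definable family of nested balls whose set of radii tends to `+∞` has non-empty
intersection. -/
def IsDefinablyComplete (v : AddValuation K (WithTop Γ)) : Prop :=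
  ∀ (n : ℕ) (W : Set (Fin n → K)) (X : Set ((Fin n → K) × K)), IsDefinableFamily L W X →
    (∀ w ∈ W, IsVBall v (fibre X w)) →
    (∀ w ∈ W, ∀ w' ∈ W, fibre X w ⊆ fibre X w' ∨ fibre X w' ⊆ fibre X w) →
    (∀ γ : Γ, ∃ w ∈ W, ∃ ρ : WithTop Γ, (γ : WithTop Γ) < ρ ∧ IsVBallOfRadius v (fibre X w) ρ) →
    ∃ x : K, ∀ w ∈ W, x ∈ fibre X w

/-- `g : Γ → Γ` is definable (that is, interpretable) in the valued field: the pullback of its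
graph to `K × K` is definable. -/
def DefinableGammaFun (v : AddValuation K (WithTop Γ)) (g : Γ → Γ) : Prop :=
  (Set.univ : Set K).Definable L
    {z : Fin 2 → K | ∃ γ : Γ, v (z 0) = (γ : WithTop Γ) ∧ v (z 1) = (g γ : WithTop Γ)}

/-- `g γ = r γ + α` for all large `γ`, with `r` rational. (The equation is cleared of the
denominator of `r`; the value group of an algebraically closed field is divisible and
torsion-free.) -/
def EventuallyQLinear (g : Γ → Γ) : Prop :=
  ∃ (r : ℚ) (α δ : Γ), ∀ γ : Γ, δ < γ → r.den • (g γ - α) = r.num • γ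

end Hypotheses

/-! ### `RV` and the Jacobian property -/

section Jacobian

variable {K Γ : Type*} [Field K] [AddCommGroup Γ] [LinearOrder Γ] [IsOrderedAddMonoid Γ]

/-- The subgroup `1 + 𝓜` of `Kˣ`, where `𝓜` is the maximal ideal of the valuation ring. -/
def oneAddMaximal (v : AddValuation K (WithTop Γ)) : Subgroup Kˣ where
  carrier := {u | 0 < v ((u : K) - 1)}
  one_mem' := by simp
  mul_mem' := by
    intro a b ha hb
    have hb0 : v (b : K) = 0 := (v.map_eq_of_lt_sub (by simpa using hb)).trans v.map_one
    have h : ((a * b : Kˣ) : K) - 1 = ((a : K) - 1) * b + ((b : K) - 1) := by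
      push_cast
      ring
    have ha' : 0 < v (((a : K) - 1) * b) := by
      rw [v.map_mul, hb0, add_zero]
      exact ha
    change 0 < v (((a * b : Kˣ) : K) - 1)
    rw [h]
    exact v.map_lt_add ha' hb
  inv_mem' := by
    intro a ha
    have ha0 : v (a : K) = 0 := (v.map_eq_of_lt_sub (by simpa using ha)).trans v.map_one
    have hi : v ((a⁻¹ : Kˣ) : K) = 0 := by
      have h := v.map_mul (a : K) ((a⁻¹ : Kˣ) : K)
      rw [ha0, zero_add, Units.mul_inv, v.map_one] at h
      exact h.symm
    have h : ((a⁻¹ : Kˣ) : K) - 1 = -(((a : K) - 1) * ((a⁻¹ : Kˣ) : K)) := by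
      rw [sub_mul, Units.mul_inv]
      ring
    change 0 < v (((a⁻¹ : Kˣ) : K) - 1)
    rw [h, v.map_neg, v.map_mul, hi, add_zero]
    exact ha

/-- `RV = Kˣ / (1 + 𝓜) ∪ {0}`. -/
def RV (v : AddValuation K (WithTop Γ)) : Type _ := WithZero (Kˣ ⧸ oneAddMaximal v)

noncomputable instance instRVCommGroupWithZero (v : AddValuation K (WithTop Γ)) :
    CommGroupWithZero (RV v) :=
  inferInstanceAs (CommGroupWithZero (WithZero (Kˣ ⧸ oneAddMaximal v)))

/-- The class in `RV` of a unit of `K`. -/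
def RV.mk (v : AddValuation K (WithTop Γ)) (u : Kˣ) : RV v :=
  ((QuotientGroup.mk u : Kˣ ⧸ oneAddMaximal v) : WithZero (Kˣ ⧸ oneAddMaximal v))

open Classical in
/-- The quotient map `K → RV`, sending `0` to `0`. -/
noncomputable def rv (v : AddValuation K (WithTop Γ)) (x : K) : RV v :=
  if h : x = 0 then 0 else RV.mk v (Units.mk0 x h)

/-- `d` is the derivative at `x` of the function `f` with domain `B`, for the valuation topology. -/
def HasVDerivOn (v : AddValuation K (WithTop Γ)) (f : K → K) (B : Set K) (d x : K) : Prop :=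
  ∀ γ : Γ, ∃ δ : Γ, ∀ y ∈ B, y ≠ x → (δ : WithTop Γ) < v (y - x) →
    (γ : WithTop Γ) < v ((f y - f x) / (y - x) - d)

/-- The function `f`, restricted to the open ball `B`, has the Jacobian property. -/
def HasJacobianProperty (v : AddValuation K (WithTop Γ)) (f : K → K) (B : Set K) : Prop :=
  IsOpenVBall v B ∧ Set.InjOn f B ∧ IsOpenVBall v (f '' B) ∧
    ∃ f' : K → K, (∀ x ∈ B, HasVDerivOn v f B (f' x) x) ∧ (∀ x ∈ B, f' x ≠ 0) ∧
      ∃ c : RV v, (∀ x ∈ B, rv v (f' x) = c) ∧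
        ∀ x ∈ B, ∀ y ∈ B, rv v (f x - f y) = rv v (x - y) * c

/-- Every point of `S` has an open ball around it, contained in `S`, on which `f` has the Jacobian
property. -/
def HasLocallyJacobianProperty (v : AddValuation K (WithTop Γ)) (f : K → K) (S : Set K) : Prop :=
  ∀ x ∈ S, ∃ B ⊆ S, x ∈ B ∧ HasJacobianProperty v f B

/-- Every point of `S` has an open ball around it, contained in `S`, on which `f` is constant. -/
def IsLocallyConstOn (v : AddValuation K (WithTop Γ)) (f : K → K) (S : Set K) : Prop :=
  ∀ x ∈ S, ∃ B ⊆ S, x ∈ B ∧ IsOpenVBall v B ∧ ∀ y ∈ B, f y = f x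

end Jacobian

/-!
The theorem is a statement about one variable. The conditions "`f w` is constant on some ball
around `x` inside `X_w`" and "`f w` has the Jacobian property on such a ball" are first-order
(`LocConstAt`, `LocJacAt`), so they define `E` and `J`; they exclude each other, and `F` is the
rest of `X`. If a fibre `F_w` were infinite it would contain a ball, by `C`-minimality, and it
remains to see that a definable function `G : K → K` on a ball is constant or has the Jacobian
property on some smaller ball (`exists_ob_const_or_jacAt`).

Compactness, in the form of an ultrapower, makes `C`-minimality uniform: the members of a definable
family are described by a bounded number of balls (`exists_ballDet_family`). As the residue field is
infinite, a definable subset of a closed ball then either meets boundedly many residue classes or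
contains all but boundedly many. Two consequences are used throughout: a property `R x e` that
holds for each `x` once `v e` is large holds on a smaller ball with the same `e`
(`exists_ob_uniform`), and a definable function to the value group is constant on a smaller ball
(`exists_ob_val_const`).

Near `0`, a definable function from `K` to the value group factors through the valuation, so it is
`ℚ`-linear in `v y` by hypothesis (`eventually_qlinear`). With definable completeness it follows
that a definable function that is bounded near `0` has a limit at `0` (`exists_vtendsto`).

Linearity applied to `y ↦ v (G (x + y) - G x)`, and uniformity, yield a ball on which `G` is
constant or `v (G x - G y)` is a linear function of `v (x - y)`, of slope `p / q`
(`exists_ob_const_or_slope`). The slope is `1` (`slope_eq_one`): with `f t = G (a + t) - G a`, the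
limit `M u` of `f (y u) / f y` as `y` tends to `0` is multiplicative, and the limit of
`(M (1 + y u) - 1) / (M (1 + y) - 1)` is an additive function `A`; both have slope `p / q`. As
`A 1 = 1`, `A` fixes the natural numbers. The definable set of its fixed points is infinite, hence
contains a ball, and so the slope is `1`.

Slope `1` makes the value of the difference quotients constant, so `G` has a derivative, of constant
value, everywhere on the ball. The same dichotomy applied to the derivative makes its class in `RV` constant on a
smaller ball (`exists_ob_derivative`). Uniformity turns the convergence of difference quotients into
the condition on `rv (G x - G y)`, and the infinite image of the ball contains a ball, which gives
the last part of the Jacobian property.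
-/

/-! ### A calculus of definable predicates -/

section Calculus

variable (L : FirstOrder.Language) {K Γ : Type*} [L.Structure K]

/-- The predicate `P` on tuples is definable with parameters. Being a class, it is established by
instance search along the shape of `P`. -/
class Dfn {α : Type} (P : (α → K) → Prop) : Prop where
  out : (Set.univ : Set K).Definable L {z | P z}

/-- The `K`-valued function `g` of tuples has a definable graph. -/
class DfnF {α : Type} (g : (α → K) → K) : Prop where
  out : Dfn L fun z : Option α → K => g (fun i => z (some i)) = z none

/-- The unary function `g` has a definable graph. -/
class DfnF₁ (g : K → K) : Prop where
  out : DfnF L fun z : Fin 1 → K => g (z 0)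

/-- The binary function `g` has a definable graph. -/
class DfnF₂ (g : K → K → K) : Prop where
  out : DfnF L fun z : Fin 2 → K => g (z 0) (z 1)

/-- The unary predicate `P` is definable. -/
class Dfn₁ (P : K → Prop) : Prop where
  out : Dfn L fun z : Fin 1 → K => P (z 0)

/-- The binary predicate `P` is definable. -/
class Dfn₂ (P : K → K → Prop) : Prop where
  out : Dfn L fun z : Fin 2 → K => P (z 0) (z 1)

variable {L} {α β : Type}

instance Dfn.and {P Q : (α → K) → Prop} [hP : Dfn L P] [hQ : Dfn L Q] :
    Dfn L fun z => P z ∧ Q z := ⟨hP.out.inter hQ.out⟩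

instance Dfn.or {P Q : (α → K) → Prop} [hP : Dfn L P] [hQ : Dfn L Q] :
    Dfn L fun z => P z ∨ Q z := ⟨hP.out.union hQ.out⟩

instance Dfn.not {P : (α → K) → Prop} [hP : Dfn L P] :
    Dfn L fun z => ¬ P z := ⟨hP.out.compl⟩

theorem Dfn.congr {P Q : (α → K) → Prop} (hP : Dfn L P) (h : ∀ z, Q z ↔ P z) : Dfn L Q :=
  (funext fun z => propext (h z) : Q = P) ▸ hP

instance Dfn.imp {P Q : (α → K) → Prop} [Dfn L P] [Dfn L Q] :
    Dfn L fun z => P z → Q z :=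
  Dfn.congr (P := fun z => ¬ P z ∨ Q z) inferInstance fun _ => imp_iff_not_or

instance Dfn.const (P : Prop) : Dfn L fun _ : α → K => P := by
  by_cases h : P
  · exact ⟨by simp [h]⟩
  · exact ⟨by simp [h]⟩

theorem Dfn.comap {P : (α → K) → Prop} (hP : Dfn L P) (f : α → β) :
    Dfn L fun z : β → K => P fun i => z (f i) :=
  ⟨hP.out.preimage_comp f⟩

theorem Dfn.exists_sum [Finite β] {P : (α ⊕ β → K) → Prop} (hP : Dfn L P) :
    Dfn L fun z : α → K => ∃ u : β → K, P (Sum.elim z u) :=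
  ⟨hP.out.exists_of_finite⟩

instance Dfn.exists {P : (α → K) → K → Prop}
    [hP : Dfn L fun z : Option α → K => P (fun i => z (some i)) (z none)] :
    Dfn L fun z : α → K => ∃ x, P z x := by
  refine Dfn.congr (Dfn.exists_sum (β := Unit)
    (hP.comap (fun o : Option α => o.elim (Sum.inr ()) Sum.inl))) fun z => ?_
  exact ⟨fun ⟨x, hx⟩ => ⟨fun _ => x, hx⟩, fun ⟨u, hu⟩ => ⟨u (), hu⟩⟩

instance Dfn.forall {P : (α → K) → K → Prop}
    [hP : Dfn L fun z : Option α → K => P (fun i => z (some i)) (z none)] :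
    Dfn L fun z : α → K => ∀ x, P z x :=
  Dfn.congr (P := fun z => ¬ ∃ x, ¬ P z x) inferInstance fun z => by push Not; rfl

theorem Dfn.forall_finite {ι : Type} [Finite ι] {P : ι → (α → K) → Prop}
    (hP : ∀ i, Dfn L (P i)) : Dfn L fun z => ∀ i, P i z := by
  refine ⟨?_⟩
  convert Set.definable_iInter_of_finite fun i => (hP i).out
  ext z
  simp

theorem dfn_var_eq (i j : α) : Dfn L fun z : α → K => z i = z j :=
  ⟨⟨(Language.var i).equal (Language.var j), by ext; simp⟩⟩

instance dfnF_var (i : α) : DfnF L fun z : α → K => z i := ⟨dfn_var_eq _ _⟩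

instance dfnF_const (a : K) : DfnF L fun _ : α → K => a :=
  ⟨⟨⟨(L.con (⟨a, trivial⟩ : (Set.univ : Set K))).term.equal (Language.var none), by
    ext; simp⟩⟩⟩

/-- Substitution of definable functions into a definable predicate. -/
theorem Dfn.subst {ι : Type} [Finite ι] {P : (ι → K) → Prop} (hP : Dfn L P)
    {g : ι → (α → K) → K} (hg : ∀ i, DfnF L (g i)) : Dfn L fun z => P fun i => g i z := by
  have h1 : Dfn L fun z : α ⊕ ι → K => ∀ i, g i (fun a => z (Sum.inl a)) = z (Sum.inr i) :=
    Dfn.forall_finite fun i =>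
      (hg i).out.comap (fun o : Option α => o.elim (Sum.inr i) Sum.inl)
  have h2 : Dfn L fun z : α ⊕ ι → K => P fun i => z (Sum.inr i) := hP.comap Sum.inr
  refine Dfn.congr (Dfn.exists_sum (β := ι) (@Dfn.and _ _ _ _ _ _ h1 h2)) fun z => ?_
  constructor
  · exact fun h => ⟨fun i => g i z, fun _ => rfl, h⟩
  · rintro ⟨u, hu, h⟩
    have : u = fun i => g i z := funext fun i => (hu i).symm
    rwa [this] at h

instance Dfn.eq {g h : (α → K) → K} [hg : DfnF L g] [hh : DfnF L h] :
    Dfn L fun z => g z = h z :=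
  Dfn.subst (g := ![g, h]) (dfn_var_eq (0 : Fin 2) 1) (by
    intro i; fin_cases i <;> assumption)

instance Dfn.ne {g h : (α → K) → K} [hg : DfnF L g] [hh : DfnF L h] :
    Dfn L fun z => g z ≠ h z := Dfn.not

theorem DfnF.comap {g : (α → K) → K} (hg : DfnF L g) (f : α → β) :
    DfnF L fun z : β → K => g fun i => z (f i) :=
  ⟨hg.out.comap fun o : Option α => o.map f⟩

instance DfnF.weaken {g : (α → K) → K} [hg : DfnF L g] :
    DfnF L fun z : Option α → K => g fun i => z (some i) := hg.comap some

/-- Substitution of definable functions into a definable function. -/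
theorem DfnF.subst {ι : Type} [Finite ι] {f : (ι → K) → K} (hf : DfnF L f)
    {g : ι → (α → K) → K} (hg : ∀ i, DfnF L (g i)) : DfnF L fun z => f fun i => g i z :=
  ⟨Dfn.subst (g := fun o z => o.elim (z none) fun i => g i fun a => z (some a)) hf.out
    (by rintro (_ | i)
        · exact dfnF_var none
        · exact (hg i).comap some)⟩

instance DfnF₁.comp {f : K → K} [hf : DfnF₁ L f] {g : (α → K) → K} [hg : DfnF L g] :
    DfnF L fun z => f (g z) :=
  DfnF.subst (g := ![g]) hf.out (by intro i; fin_cases i; assumption)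

instance DfnF₂.comp {f : K → K → K} [hf : DfnF₂ L f] {g h : (α → K) → K} [hg : DfnF L g]
    [hh : DfnF L h] : DfnF L fun z => f (g z) (h z) :=
  DfnF.subst (g := ![g, h]) hf.out (by intro i; fin_cases i <;> assumption)

instance Dfn₁.comp {P : K → Prop} [hP : Dfn₁ L P] {g : (α → K) → K} [hg : DfnF L g] :
    Dfn L fun z => P (g z) :=
  Dfn.subst (g := ![g]) hP.out (by intro i; fin_cases i; assumption)

instance Dfn₂.comp {P : K → K → Prop} [hP : Dfn₂ L P] {g h : (α → K) → K} [hg : DfnF L g]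
    [hh : DfnF L h] : Dfn L fun z => P (g z) (h z) :=
  Dfn.subst (g := ![g, h]) hP.out (by intro i; fin_cases i <;> assumption)

instance (priority := low) Dfn₁.of_dfn {P : K → Prop} [h : Dfn L fun z : Fin 1 → K => P (z 0)] :
    Dfn₁ L P := ⟨h⟩

instance (priority := low) Dfn₂.of_dfn {P : K → K → Prop}
    [h : Dfn L fun z : Fin 2 → K => P (z 0) (z 1)] : Dfn₂ L P := ⟨h⟩

instance (priority := low) DfnF₁.of_dfnF {g : K → K} [h : DfnF L fun z : Fin 1 → K => g (z 0)] :
    DfnF₁ L g := ⟨h⟩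

/-- A function is definable once its graph is. -/
theorem dfnF_of_graph {g : (α → K) → K} {P : (α → K) → K → Prop} (h : ∀ z x, g z = x ↔ P z x)
    (hP : Dfn L fun z : Option α → K => P (fun i => z (some i)) (z none)) : DfnF L g :=
  ⟨hP.congr fun _ => h _ _⟩

variable [Field K]

variable (L K) in
/-- The field operations of `K` are definable. -/
class DfnField : Prop where
  add : DfnF₂ L fun x y : K => x + y
  mul : DfnF₂ L fun x y : K => x * y

instance DfnF.add [h : DfnField L K] {f g : (α → K) → K} [DfnF L f] [DfnF L g] :
    DfnF L fun z => f z + g z := h.add.comp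

instance DfnF.mul [h : DfnField L K] {f g : (α → K) → K} [DfnF L f] [DfnF L g] :
    DfnF L fun z => f z * g z := h.mul.comp

instance DfnF.sub [h : DfnField L K] {f g : (α → K) → K} [DfnF L f] [DfnF L g] :
    DfnF L fun z => f z - g z :=
  dfnF_of_graph (P := fun z x => f z = x + g z) (fun _ _ => sub_eq_iff_eq_add) inferInstance

instance DfnF.div [h : DfnField L K] {f g : (α → K) → K} [DfnF L f] [DfnF L g] :
    DfnF L fun z => f z / g z :=
  dfnF_of_graph (P := fun z x => (g z = 0 ∧ x = 0) ∨ (g z ≠ 0 ∧ f z = x * g z)) (fun z x => by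
    by_cases h : g z = 0
    · simp [h, eq_comm]
    · simp [h, div_eq_iff]) inferInstance

variable [AddCommGroup Γ] [LinearOrder Γ] [IsOrderedAddMonoid Γ]

variable (L) in
/-- The valuation `v` is definable and surjective, so that `Γ ∪ {+∞}` is an imaginary sort. -/
class DfnVal (v : outParam (AddValuation K (WithTop Γ))) : Prop where
  le : Dfn₂ L fun x y => v x ≤ v y
  surj : Function.Surjective v

variable (v : AddValuation K (WithTop Γ))

variable (L) in
/-- The value-group-valued function `d` of tuples is definable: the set of all `(z, x)` with
`v x ≤ d z` is definable. -/
class DfnV {α : Type} (d : (α → K) → WithTop Γ) : Prop where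
  out : Dfn L fun z : Option α → K => v (z none) ≤ d fun i => z (some i)

instance DfnV.val [h : DfnVal L v] {g : (α → K) → K} [hg : DfnF L g] :
    DfnV L v fun z => v (g z) := ⟨h.le.comp⟩

variable (L) in
/-- The unary value-group-valued function `d` is definable. -/
class DfnV₁ (d : K → WithTop Γ) : Prop where
  out : DfnV L v fun z : Fin 1 → K => d (z 0)

instance (priority := low) DfnV₁.of_dfnV {d : K → WithTop Γ}
    [h : DfnV L v fun z : Fin 1 → K => d (z 0)] : DfnV₁ L v d := ⟨h⟩

instance DfnV₁.comp {d : K → WithTop Γ} [hd : DfnV₁ L v d] {g : (α → K) → K} [hg : DfnF L g] :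
    DfnV L v fun z => d (g z) :=
  ⟨Dfn.subst (ι := Option (Fin 1)) (g := fun o z => o.elim (z none) fun _ => g fun i => z (some i))
    hd.out.out (by
      rintro (_ | i)
      · exact dfnF_var none
      · exact hg.comap some)⟩

variable {v}

instance Dfn.le [hv : DfnVal L v] {d e : (α → K) → WithTop Γ} [hd : DfnV L v d]
    [he : DfnV L v e] : Dfn L fun z => d z ≤ e z := by
  have h1 := hd.out
  have h2 := he.out
  refine Dfn.congr (P := fun z => ∀ x, v x ≤ d z → v x ≤ e z) inferInstance fun z => ?_
  refine ⟨fun h x hx => hx.trans h, fun h => ?_⟩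
  obtain ⟨x, hx⟩ := hv.surj (d z)
  exact hx ▸ h x hx.le

instance Dfn.lt [hv : DfnVal L v] {d e : (α → K) → WithTop Γ} [hd : DfnV L v d]
    [he : DfnV L v e] : Dfn L fun z => d z < e z :=
  Dfn.congr (P := fun z => ¬ e z ≤ d z) inferInstance fun _ => not_le.symm

instance Dfn.veq [hv : DfnVal L v] {d e : (α → K) → WithTop Γ} [hd : DfnV L v d]
    [he : DfnV L v e] : Dfn L fun z => d z = e z :=
  Dfn.congr (P := fun z => d z ≤ e z ∧ e z ≤ d z) inferInstance fun _ => le_antisymm_iff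

/-! ### Germs at zero -/

variable (v) in
/-- The filter of punctured neighbourhoods of `0`. -/
def nz : Filter K := ⨅ c : {c : K // c ≠ 0}, Filter.principal {y | y ≠ 0 ∧ v c < v y}

theorem eventually_nz {P : K → Prop} :
    (∀ᶠ y in nz v, P y) ↔ ∃ c, c ≠ 0 ∧ ∀ y, y ≠ 0 → v c < v y → P y := by
  have : Nonempty {c : K // c ≠ 0} := ⟨⟨1, one_ne_zero⟩⟩
  rw [nz, Filter.Eventually, Filter.mem_iInf_of_directed]
  · constructor
    · rintro ⟨⟨c, hc⟩, h⟩
      exact ⟨c, hc, fun y hy hcy => h ⟨hy, hcy⟩⟩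
    · rintro ⟨c, hc, h⟩
      exact ⟨⟨c, hc⟩, fun y hy => h y hy.1 hy.2⟩
  · rintro ⟨a, ha⟩ ⟨b, hb⟩
    rcases le_total (v a) (v b) with h | h
    · exact ⟨⟨b, hb⟩, Filter.principal_mono.2 fun y hy => ⟨hy.1, h.trans_lt hy.2⟩, le_rfl⟩
    · exact ⟨⟨a, ha⟩, le_rfl, Filter.principal_mono.2 fun y hy => ⟨hy.1, h.trans_lt hy.2⟩⟩

instance Dfn.eventually [DfnVal L v] {P : (α → K) → K → Prop}
    [hP : Dfn L fun z : Option α → K => P (fun i => z (some i)) (z none)] :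
    Dfn L fun z : α → K => ∀ᶠ y in nz v, P z y := by
  have : Dfn L fun z : Option (Option α) → K =>
      P (fun i => z (some (some i))) (z none) := hP.comap fun o : Option α => o.map some
  refine Dfn.congr (P := fun z => ∃ c, c ≠ 0 ∧ ∀ y, y ≠ 0 → v c < v y → P z y) inferInstance
    fun z => eventually_nz

end Calculus

/-! ### Uniform `C`-minimality -/

section Uniform

open Filter

variable {K Γ : Type*} [Field K] [AddCommGroup Γ] [LinearOrder Γ] [IsOrderedAddMonoid Γ]
  (v : AddValuation K (WithTop Γ))

/-- Membership in `S` only depends on membership in each of at most `N` suitable balls. -/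
def BallDet (N : ℕ) (S : Set K) : Prop :=
  ∃ D : Finset (Set K), D.card ≤ N ∧ (∀ B ∈ D, IsVBall v B) ∧
    ∀ x y, (∀ B ∈ D, x ∈ B ↔ y ∈ B) → (x ∈ S ↔ y ∈ S)

variable {v}

theorem BallDet.mono {m n : ℕ} {S : Set K} (h : BallDet v m S) (hmn : m ≤ n) : BallDet v n S :=
  let ⟨D, hD, h'⟩ := h
  ⟨D, hD.trans hmn, h'⟩

theorem IsVBall.ballDet {B : Set K} (h : IsVBall v B) : BallDet v 1 B :=
  ⟨{B}, by simp, by simpa using h, fun x y hxy => hxy B (by simp)⟩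

theorem BallDet.compl {n : ℕ} {S : Set K} (h : BallDet v n S) : BallDet v n Sᶜ :=
  let ⟨D, hD, hb, h'⟩ := h
  ⟨D, hD, hb, fun x y hxy => not_congr (h' x y hxy)⟩

theorem BallDet.union {m n : ℕ} {S T : Set K} (hS : BallDet v m S) (hT : BallDet v n T) :
    BallDet v (m + n) (S ∪ T) := by
  classical
  obtain ⟨D, hD, hb, h⟩ := hS
  obtain ⟨D', hD', hb', h'⟩ := hT
  refine ⟨D ∪ D', (Finset.card_union_le _ _).trans (by omega), fun B hB => ?_, fun x y hxy => ?_⟩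
  · rcases Finset.mem_union.1 hB with hB | hB
    exacts [hb B hB, hb' B hB]
  · exact or_congr (h x y fun B hB => hxy B (Finset.mem_union_left _ hB))
      (h' x y fun B hB => hxy B (Finset.mem_union_right _ hB))

end Uniform

theorem dfnF_funMap {L : FirstOrder.Language} {K : Type*} [L.Structure K] {n : ℕ}
    (f : L.Functions n) :
    DfnF L fun z : Fin n → K => Language.Structure.funMap f z := by
  refine ⟨⟨Set.definable_iff_exists_formula_sum.2 ⟨Language.Term.equal
    (Language.Term.func f fun i => Language.var (Sum.inr (some i)))
    (Language.var (Sum.inr none)), ?_⟩⟩⟩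
  ext z
  simp

section Uniform

open Filter

universe u₁ u₂ u₃ u₄

variable {L : FirstOrder.Language.{u₁, u₂}} (ι : divLang →ᴸ L)
  {K : Type u₃} {Γ : Type u₄} [L.Structure K] [Field K]
  [AddCommGroup Γ] [LinearOrder Γ] [IsOrderedAddMonoid Γ] (v : AddValuation K (WithTop Γ))

variable {ι v}

theorem langSub_eq (hι : letI := divStructure v; ι.IsExpansionOn K) (x y : K) :
    langSub ι x y = x - y := by
  have h1 := @Language.LHom.IsExpansionOn.map_onFunction _ _ ι K (divStructure v) _ hι 1
    ringFunc.neg ![y]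
  have h2 := @Language.LHom.IsExpansionOn.map_onFunction _ _ ι K (divStructure v) _ hι 2
    ringFunc.add ![x, -y]
  rw [sub_eq_add_neg]
  refine Eq.trans ?_ h2
  unfold langSub
  exact congrArg (fun t => Language.Structure.funMap _ ![x, t]) h1

theorem langDiv_iff (hι : letI := divStructure v; ι.IsExpansionOn K) (x y : K) :
    langDiv ι x y ↔ v x ≤ v y :=
  iff_of_eq (@Language.LHom.IsExpansionOn.map_onRelation _ _ ι K (divStructure v) _ hι 2
    DivRel.div ![x, y])

theorem langZero_eq (hι : letI := divStructure v; ι.IsExpansionOn K) :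
    langZero ι K = (0 : K) :=
  @Language.LHom.IsExpansionOn.map_onFunction _ _ ι K (divStructure v) _ hι 0 ringFunc.zero ![]

theorem dfnField_of_expansion (hι : letI := divStructure v; ι.IsExpansionOn K) :
    DfnField L K where
  add := ⟨by
    convert dfnF_funMap (K := K) (ι.onFunction (n := 2) ringFunc.add) with z
    exact (@Language.LHom.IsExpansionOn.map_onFunction _ _ ι K (divStructure v) _ hι 2
      ringFunc.add z).symm⟩
  mul := ⟨by
    convert dfnF_funMap (K := K) (ι.onFunction (n := 2) ringFunc.mul) with z
    exact (@Language.LHom.IsExpansionOn.map_onFunction _ _ ι K (divStructure v) _ hι 2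
      ringFunc.mul z).symm⟩

theorem dfnVal_of_expansion (hv : Function.Surjective v)
    (hι : letI := divStructure v; ι.IsExpansionOn K) : DfnVal L v where
  le := ⟨⟨Set.definable_iff_exists_formula_sum.2 ⟨Language.Relations.formula
    (ι.onRelation (n := 2) DivRel.div) fun i => Language.var (Sum.inr i), by
      ext z
      refine Iff.trans (iff_of_eq (@Language.LHom.IsExpansionOn.map_onRelation _ _ ι K
        (divStructure v) _ hι 2 DivRel.div z)).symm ?_
      simp [Language.Formula.realize_rel]⟩⟩⟩
  surj := hv

/-- By `C`-minimality of an ultrapower of `K`, the number of balls needed to describe the members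
of a definable family of subsets of `K` is bounded. -/
theorem exists_ballDet_family (hι : letI := divStructure v; ι.IsExpansionOn K)
    (hC : IsCMinimal ι K) {α : Type} (P : (α → K) → K → Prop)
    (hP : Dfn L fun z : Option α → K => P (fun i => z (some i)) (z none)) :
    ∃ N, ∀ z, BallDet v N {x | P z x} := by
  by_contra! hbad
  choose z hz using hbad
  let I := ULift.{max u₁ u₂} ℕ
  let u : Ultrafilter I := hyperfilter I
  let M : Type (max u₁ u₂ u₃) := (u : Filter I).Product fun _ => K
  let mk : (I → K) → M := fun x => (x : (u : Filter I).Product fun _ => K)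
  have mk_surj : ∀ m : M, ∃ x, mk x = m := fun m => Quotient.exists_rep m
  let _ : L.Structure M := Language.Ultraproduct.structure
  have hfun : ∀ {n : ℕ} (f : L.Functions n) (X : Fin n → M) (x : Fin n → I → K),
      (∀ i, X i = mk (x i)) → Language.Structure.funMap f X =
        mk fun k => Language.Structure.funMap f fun i => x i k := by
    intro n f X x hX
    rw [funext hX]
    exact Language.Ultraproduct.funMap_cast f x
  have hsub : ∀ x y : I → K, langSub ι (mk x) (mk y) = mk fun k => x k - y k := by
    intro x y
    unfold langSub
    rw [hfun _ ![mk y] ![y] fun i => by fin_cases i; rfl]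
    rw [hfun _ ![mk x, _] ![x, _] fun i => by fin_cases i <;> rfl]
    congr 1
    funext k
    rw [← langSub_eq hι]
    unfold langSub
    congr 1
    funext i
    fin_cases i
    · rfl
    · refine congrArg _ (funext fun j => ?_)
      fin_cases j
      rfl
  have hdiv : ∀ x y : I → K, langDiv ι (mk x) (mk y) ↔ ∀ᶠ k in u, v (x k) ≤ v (y k) := by
    intro x y
    have h := Language.Ultraproduct.realize_formula_cast (u := u) (Language.Relations.formula
      (ι.onRelation (n := 2) DivRel.div) fun i => Language.var i) ![x, y]
    simp only [Language.Formula.realize_rel, Language.Term.realize_var] at h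
    refine Iff.trans ?_ (h.trans (eventually_congr (Eventually.of_forall fun k => ?_)))
    · unfold langDiv
      refine iff_of_eq (congrArg _ (funext fun i => ?_))
      fin_cases i <;> rfl
    · rw [← langDiv_iff hι]
      unfold langDiv
      refine iff_of_eq (congrArg _ (funext fun i => ?_))
      fin_cases i <;> rfl
  have hzero : langZero ι M = mk fun _ => 0 := by
    unfold langZero
    rw [hfun _ ![] ![] fun i => i.elim0]
    congr 1
    funext k
    rw [← langZero_eq hι]
    exact congrArg _ (funext fun i => i.elim0)
  have mk_eq : ∀ x y : I → K, mk x = mk y ↔ ∀ᶠ k in u, x k = y k := fun x y => Quotient.eq''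
  have hM : L.ElementarilyEquivalent K M := by
    rw [Language.elementarilyEquivalent_iff]
    intro φ
    rw [Language.Ultraproduct.sentence_realize]
    simp
  have key : ∀ S ∈ BooleanSubalgebra.closure {B : Set M | IsLangBall ι B},
      ∃ (N : ℕ) (T : I → Set K), (∀ x, mk x ∈ S ↔ ∀ᶠ k in u, x k ∈ T k) ∧
        ∀ k, BallDet v N (T k) := by
    intro S hS
    induction hS using BooleanSubalgebra.closure_bot_sup_induction with
    | mem B hB =>
      refine ⟨1, ?_⟩
      rcases hB with rfl | ⟨a, b, hB⟩
      · exact ⟨fun _ => Set.univ, by simp, fun _ => IsVBall.ballDet (Or.inl (Or.inl rfl))⟩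
      obtain ⟨a, rfl⟩ := mk_surj a
      obtain ⟨b, rfl⟩ := mk_surj b
      rcases hB with rfl | ⟨hb, rfl⟩
      · refine ⟨fun k => vClosedBall v (a k) (v (b k)), fun x => ?_, fun k =>
          IsVBall.ballDet (Or.inr ⟨_, _, rfl⟩)⟩
        change langDiv ι (mk b) (langSub ι (mk x) (mk a)) ↔ _
        rw [hsub, hdiv]
        rfl
      · have hb' : ∀ᶠ k in u, b k ≠ 0 := by
          rw [hzero, Ne, mk_eq] at hb
          exact Ultrafilter.eventually_not.2 hb
        classical
        refine ⟨fun k => if b k = 0 then Set.univ else {x | v (b k) < v (x - a k)}, fun x => ?_,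
          fun k => IsVBall.ballDet ?_⟩
        · change ¬ langDiv ι (langSub ι (mk x) (mk a)) (mk b) ↔ _
          rw [hsub, hdiv, ← Ultrafilter.eventually_not]
          refine eventually_congr (hb'.mono fun k hk => ?_)
          simp [hk]
        · by_cases hk : b k = 0
          · beta_reduce
            rw [if_pos hk]
            exact Or.inl (Or.inl rfl)
          · beta_reduce
            rw [if_neg hk]
            have := (AddValuation.ne_top_iff v).2 hk
            obtain ⟨γ, hγ⟩ := WithTop.ne_top_iff_exists.1 this
            exact Or.inl (Or.inr ⟨a k, γ, by rw [← hγ]; rfl⟩)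
    | bot => exact ⟨1, fun _ => Set.univᶜ, by simp [u.neBot.ne], fun _ =>
        (IsVBall.ballDet (Or.inl (Or.inl rfl))).compl⟩
    | sup S _ S' _ h h' =>
      obtain ⟨N, T, h1, h2⟩ := h
      obtain ⟨N', T', h1', h2'⟩ := h'
      refine ⟨N + N', fun k => T k ∪ T' k, fun x => ?_, fun k => (h2 k).union (h2' k)⟩
      change mk x ∈ S ∨ mk x ∈ S' ↔ _
      rw [h1, h1', ← Ultrafilter.eventually_or]
      rfl
    | compl S _ h =>
      obtain ⟨N, T, h1, h2⟩ := h
      refine ⟨N, fun k => (T k)ᶜ, fun x => ?_, fun k => (h2 k).compl⟩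
      change ¬ mk x ∈ S ↔ _
      rw [h1, ← Ultrafilter.eventually_not]
      rfl
  obtain ⟨φ, hφ⟩ := Set.definable_iff_exists_formula_sum.1 hP.out
  let S : Set M := {m | φ.Realize (Sum.elim (fun a => mk fun _ => a.1)
    fun o => o.elim m fun i => mk fun k => z k.down i)}
  have hS : (Set.univ : Set M).Definable₁ L S := by
    refine Set.definable_iff_exists_formula_sum.2 ⟨φ.relabel (Sum.elim
      (fun a => Sum.inl ⟨mk fun _ => a.1, trivial⟩) fun o => o.elim (Sum.inr 0)
        fun i => Sum.inl ⟨mk fun k => z k.down i, trivial⟩), ?_⟩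
    ext x
    simp only [Set.mem_ofPred_eq, S, Language.Formula.realize_relabel]
    refine iff_of_eq (congrArg _ (funext fun i => ?_))
    rcases i with a | _ | i <;> rfl
  obtain ⟨N, T, h1, h2⟩ := key S (hC M hM S hS)
  have h3 : ∀ x, mk x ∈ S ↔ ∀ᶠ k in u, P (z k.down) (x k) := by
    intro x
    have := Language.Ultraproduct.realize_formula_cast (u := u) φ
      (Sum.elim (fun a _ => a.1) fun o => o.elim x fun i k => z k.down i)
    refine Iff.trans ?_ (this.trans (eventually_congr (Eventually.of_forall fun k => ?_)))
    · refine iff_of_eq (congrArg φ.Realize (funext fun i => ?_))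
      rcases i with a | _ | i <;> rfl
    · have := Set.ext_iff.1 hφ fun o => o.elim (x k) (z k.down)
      refine Iff.trans (iff_of_eq (congrArg _ (funext fun i => ?_))) this.symm
      rcases i with a | _ | i <;> rfl
  -- The traces agree at almost every index, for otherwise their differences have a point.
  have h4 : ∀ᶠ k in u, {x | P (z k.down) x} = T k := by
    by_contra h
    rw [← Ultrafilter.eventually_not] at h
    have : ∀ k, ∃ x, {x | P (z k.down) x} ≠ T k → ¬ (P (z k.down) x ↔ x ∈ T k) := by
      intro k
      by_cases hk : {x | P (z k.down) x} = T k
      · exact ⟨0, fun h => (h hk).elim⟩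
      · have h5 : ∃ x, ¬ (P (z k.down) x ↔ x ∈ T k) := by
          by_contra! h6
          exact hk (Set.ext h6)
        exact h5.imp fun x hx _ => hx
    choose x hx using this
    have h5 := (h3 x).symm.trans (h1 x)
    have h6 : ∀ᶠ k in u, ¬ (P (z k.down) (x k) ↔ x k ∈ T k) := h.mono fun k hk => hx k hk
    by_cases hm : ∀ᶠ k in u, P (z k.down) (x k)
    · exact ((hm.and ((h5.1 hm).and h6)).exists.elim fun k hk => hk.2.2 (iff_of_true hk.1 hk.2.1))
    · have hm' := Ultrafilter.eventually_not.2 hm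
      have hm'' := Ultrafilter.eventually_not.2 fun h => hm (h5.2 h)
      exact ((hm'.and (hm''.and h6)).exists.elim fun k hk => hk.2.2 (iff_of_false hk.1 hk.2.1))
  have h5 : ∀ᶠ k : I in u, N ≤ k.down := by
    have : {k : I | ¬ N ≤ k.down}.Finite := by
      have := (Set.finite_lt_nat N).preimage (f := (ULift.down : I → ℕ))
        ULift.down_injective.injOn
      exact this.subset fun k hk => not_le.1 hk
    exact Filter.mem_hyperfilter_of_finite_compl this
  obtain ⟨k, hk, hk'⟩ := (h4.and h5).exists
  exact hz k.down (hk ▸ (h2 k).mono hk')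

end Uniform

/-! ### Balls and residue classes -/

section Balls

open Filter

variable {K Γ : Type*} [Field K] [AddCommGroup Γ] [LinearOrder Γ] [IsOrderedAddMonoid Γ]
  {v : AddValuation K (WithTop Γ)}

variable (v) in
/-- The open ball around `a` whose radius is the value of `c`. -/
def ob (a c : K) : Set K := {x | v c < v (x - a)}

theorem mem_ob {a c x : K} : x ∈ ob v a c ↔ v c < v (x - a) := Iff.rfl

theorem val_lt_top {c : K} (hc : c ≠ 0) : v c < ⊤ :=
  lt_top_iff_ne_top.2 ((AddValuation.ne_top_iff v).2 hc)

theorem mem_ob_self {a c : K} (hc : c ≠ 0) : a ∈ ob v a c := by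
  simpa [mem_ob] using val_lt_top hc

theorem lt_val_sub {γ : WithTop Γ} {x y : K} (hx : γ < v x) (hy : γ < v y) : γ < v (x - y) := by
  rw [sub_eq_add_neg]
  exact v.map_lt_add hx (by rwa [v.map_neg])

theorem lt_val_sub_trans {γ : WithTop Γ} {x y z : K} (h1 : γ < v (x - y)) (h2 : γ < v (y - z)) :
    γ < v (x - z) := by
  rw [← sub_add_sub_cancel x y z]
  exact v.map_lt_add h1 h2

theorem le_val_sub_trans {γ : WithTop Γ} {x y z : K} (h1 : γ ≤ v (x - y)) (h2 : γ ≤ v (y - z)) :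
    γ ≤ v (x - z) := by
  rw [← sub_add_sub_cancel x y z]
  exact v.map_le_add h1 h2

theorem lt_val_sub_comm {γ : WithTop Γ} {x y : K} (h : γ < v (x - y)) : γ < v (y - x) := by
  rwa [v.map_sub_swap]

theorem le_val_sub_comm {γ : WithTop Γ} {x y : K} (h : γ ≤ v (x - y)) : γ ≤ v (y - x) := by
  rwa [v.map_sub_swap]

theorem ob_subset_ob {a b c d : K} (h : a ∈ ob v b d) (hcd : v d ≤ v c) :
    ob v a c ⊆ ob v b d :=
  fun _ hx => lt_val_sub_trans (hcd.trans_lt hx) h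

theorem sub_mem_of_mem_ob {a c x y : K} (hx : x ∈ ob v a c) (hy : y ∈ ob v a c) :
    v c < v (x - y) :=
  lt_val_sub_trans hx (lt_val_sub_comm hy)

variable (v) in
/-- The value of `x` as an element of `Γ`, which is the junk value `0` for `x = 0`. -/
def val (x : K) : Γ := (v x).untopD 0

theorem coe_val {x : K} (hx : x ≠ 0) : ((val v x : Γ) : WithTop Γ) = v x := by
  obtain ⟨γ, hγ⟩ := WithTop.ne_top_iff_exists.1 ((AddValuation.ne_top_iff v).2 hx)
  simp [val, ← hγ]

theorem val_mul {x y : K} (hx : x ≠ 0) (hy : y ≠ 0) : val v (x * y) = val v x + val v y := by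
  have := v.map_mul x y
  rw [← coe_val hx, ← coe_val hy, ← coe_val (mul_ne_zero hx hy)] at this
  exact_mod_cast this

theorem val_div {x y : K} (hx : x ≠ 0) (hy : y ≠ 0) : val v (x / y) = val v x - val v y := by
  have := val_mul (v := v) (div_ne_zero hx hy) hy
  rw [div_mul_cancel₀ x hy] at this
  rw [this, add_sub_cancel_right]

theorem val_neg (x : K) : val v (-x) = val v x := by
  rw [val, v.map_neg, val]

theorem val_lt_iff {x y : K} (hx : x ≠ 0) (hy : y ≠ 0) : v x < v y ↔ val v x < val v y := by
  rw [← coe_val hx, ← coe_val hy, WithTop.coe_lt_coe]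

theorem val_le_iff {x y : K} (hx : x ≠ 0) (hy : y ≠ 0) : v x ≤ v y ↔ val v x ≤ val v y := by
  rw [← coe_val hx, ← coe_val hy, WithTop.coe_le_coe]

theorem val_eq_iff {x y : K} (hx : x ≠ 0) (hy : y ≠ 0) : v x = v y ↔ val v x = val v y := by
  rw [← coe_val hx, ← coe_val hy, WithTop.coe_eq_coe]

section Surjective

variable (hv : Function.Surjective v)

include hv in
theorem exists_val_eq (γ : Γ) : ∃ c, c ≠ 0 ∧ v c = γ := by
  obtain ⟨c, hc⟩ := hv γ
  exact ⟨c, (AddValuation.ne_top_iff v).1 (by simp [hc]), hc⟩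

include hv in
theorem exists_val_gt [Nontrivial Γ] {c : K} (hc : c ≠ 0) : ∃ d, d ≠ 0 ∧ v c < v d := by
  obtain ⟨γ, hγ⟩ := WithTop.ne_top_iff_exists.1 ((AddValuation.ne_top_iff v).2 hc)
  obtain ⟨δ, hδ⟩ := exists_gt γ
  obtain ⟨d, hd, hd'⟩ := exists_val_eq hv δ
  exact ⟨d, hd, by rw [← hγ, hd']; exact_mod_cast hδ⟩

include hv in
/-- The value group of an algebraically closed field is divisible, hence densely ordered. -/
theorem exists_val_between [IsAlgClosed K] [Nontrivial Γ] {γ δ : WithTop Γ} (h : γ < δ) :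
    ∃ c, c ≠ 0 ∧ γ < v c ∧ v c < δ := by
  obtain ⟨a, rfl⟩ := hv γ
  obtain ⟨b, rfl⟩ := hv δ
  have ha : a ≠ 0 := (AddValuation.ne_top_iff v).1 h.ne_top
  by_cases hb : b = 0
  · obtain ⟨d, hd, hd'⟩ := exists_val_gt hv ha
    exact ⟨d, hd, hd', by simpa [hb] using val_lt_top hd⟩
  obtain ⟨c, hc⟩ := IsAlgClosed.exists_pow_nat_eq (a * b) two_pos
  have hc0 : c ≠ 0 := by
    rintro rfl
    exact mul_ne_zero ha hb (by simpa using hc.symm)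
  have h2 : val v c + val v c = val v a + val v b := by
    rw [← val_mul hc0 hc0, ← val_mul ha hb, ← hc, sq]
  rw [val_lt_iff ha hb] at h
  refine ⟨c, hc0, ?_, ?_⟩
  · rw [val_lt_iff ha hc0]
    grind
  · rw [val_lt_iff hc0 hb]
    grind

theorem eventually_lt_val {c : K} (hc : c ≠ 0) : ∀ᶠ y in nz v, v c < v y :=
  eventually_nz.2 ⟨c, hc, fun _ _ h => h⟩

include hv in
theorem eventually_gamma_lt (γ : Γ) : ∀ᶠ y in nz v, (γ : WithTop Γ) < v y := by
  obtain ⟨c, hc, h⟩ := exists_val_eq hv γ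
  exact h ▸ eventually_lt_val hc

theorem eventually_ne_zero : ∀ᶠ y in nz v, y ≠ 0 :=
  eventually_nz.2 ⟨1, one_ne_zero, fun _ h _ => h⟩

include hv in
theorem nz_neBot [Nontrivial Γ] : (nz v).NeBot := by
  refine ⟨fun h => ?_⟩
  have : ∀ᶠ _ in nz v, False := by simp [h]
  obtain ⟨c, hc, h⟩ := eventually_nz.1 this
  obtain ⟨d, hd, hd'⟩ := exists_val_gt hv hc
  exact h d hd hd'

theorem eventually_val_sub {a : K} (ha : a ≠ 0) : ∀ᶠ y in nz v, v (y - a) = v a :=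
  (eventually_lt_val ha).mono fun _ hy => v.map_sub_eq_of_lt_right hy

theorem eventually_mem_ob {a c : K} (hc : c ≠ 0) : ∀ᶠ y in nz v, a + y ∈ ob v a c := by
  simpa [mem_ob] using eventually_lt_val hc

theorem val_prod_nonneg {s : Finset K} {u : K} (h : ∀ t ∈ s, 0 ≤ v (u - t)) :
    0 ≤ v (∏ t ∈ s, (u - t)) :=
  Finset.prod_induction _ (fun x => 0 ≤ v x)
    (fun x y hx hy => by rw [v.map_mul]; exact add_nonneg hx hy) (by simp) h

/-- The residue field of an algebraically closed field is infinite: finitely many residue classes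
do not cover a closed ball. -/
theorem exists_residue [IsAlgClosed K] (T : Finset K) (a : K) {c : K} (hc : c ≠ 0) :
    ∃ x, v c ≤ v (x - a) ∧ ∀ t ∈ T, ¬ v c < v (x - t) := by
  classical
  -- A root `u` of `∏ (X - s) - 1` is a unit modulo each of the integral elements `s`.
  let S : Finset K := insert 0 ((T.image fun t => (t - a) / c).filter fun s => 0 ≤ v s)
  have hS : ∀ s ∈ S, 0 ≤ v s := by
    intro s hs
    rcases Finset.mem_insert.1 hs with rfl | hs
    · simp
    · exact (Finset.mem_filter.1 hs).2
  have hdeg : (∏ s ∈ S, (Polynomial.X - Polynomial.C s) - 1 : Polynomial K).degree ≠ 0 := by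
    have h1 : 0 < (∏ s ∈ S, (Polynomial.X - Polynomial.C s)).degree := by
      rw [Polynomial.degree_prod]
      simp [S]
    rw [Polynomial.degree_sub_eq_left_of_degree_lt (by rwa [Polynomial.degree_one])]
    exact h1.ne'
  obtain ⟨u, hu⟩ := IsAlgClosed.exists_root _ hdeg
  have hprod : ∏ s ∈ S, (u - s) = 1 := by
    simpa [Polynomial.IsRoot, Polynomial.eval_prod, sub_eq_zero] using hu
  have hu0 : 0 ≤ v u := by
    by_contra! h
    have : v (∏ s ∈ S, (u - s)) < 0 := by
      refine Finset.prod_induction_nonempty _ (fun x => v x < 0) (fun x y hx hy => ?_)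
        ⟨0, Finset.mem_insert_self _ _⟩ fun s hs => ?_
      · rw [v.map_mul]
        calc v x + v y ≤ v x + 0 := by gcongr
          _ < 0 := by simpa using hx
      · rwa [v.map_sub_eq_of_lt_left (h.trans_le (hS s hs))]
    simp [hprod] at this
  have hval : ∀ s ∈ S, ¬ 0 < v (u - s) := by
    intro s hs h
    have h1 : 0 ≤ v (∏ t ∈ S.erase s, (u - t)) :=
      val_prod_nonneg fun t ht => v.map_le_sub hu0 (hS t (Finset.mem_of_mem_erase ht))
    have h2 : 0 < v (∏ t ∈ S, (u - t)) := by
      rw [← Finset.mul_prod_erase S _ hs, v.map_mul]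
      exact add_pos_of_pos_of_nonneg h h1
    simp [hprod] at h2
  have hscale : ∀ y, v (y * c) = v y + v c := fun y => v.map_mul y c
  have hc' := (val_lt_top (v := v) hc).ne
  refine ⟨a + u * c, ?_, fun t ht h => ?_⟩
  · rw [add_sub_cancel_left, hscale]
    exact le_add_of_nonneg_left hu0
  · have h1 : a + u * c - t = (u - (t - a) / c) * c := by
      field_simp
      ring
    rw [h1, hscale] at h
    have h2 : 0 < v (u - (t - a) / c) := by
      by_contra! h3
      exact absurd h (not_lt.2 (by simpa using add_le_add_left h3 (v c)))
    have h3 : 0 ≤ v ((t - a) / c) := by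
      have : (t - a) / c = u - (u - (t - a) / c) := by ring
      rw [this]
      exact v.map_le_sub hu0 h2.le
    exact hval _ (Finset.mem_insert_of_mem (Finset.mem_filter.2
      ⟨Finset.mem_image_of_mem _ ht, h3⟩)) h2

include hv in
theorem ob_infinite [IsAlgClosed K] [Nontrivial Γ] (a : K) {c : K} (hc : c ≠ 0) :
    (ob v a c).Infinite := by
  intro hfin
  obtain ⟨d, hd, hcd⟩ := exists_val_gt hv hc
  obtain ⟨x, hx, hx'⟩ := exists_residue (v := v) hfin.toFinset a hd
  exact hx' x (hfin.mem_toFinset.2 (hcd.trans_le hx)) (by simpa using val_lt_top hd)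

end Surjective

/-- The punctured neighbourhoods of `0` decide membership in a ball. -/
theorem IsVBall.eventually_mem_or (hv : Function.Surjective v) {B : Set K} (hB : IsVBall v B) :
    (∀ᶠ y in nz v, y ∈ B) ∨ ∀ᶠ y in nz v, y ∉ B := by
  rcases hB with (rfl | ⟨a, γ, rfl⟩) | ⟨a, γ, rfl⟩
  · simp
  · by_cases ha : a = 0
    · left
      simpa [ha, vOpenBall] using eventually_gamma_lt hv γ
    by_cases h : (γ : WithTop Γ) < v a
    · exact Or.inl ((eventually_val_sub ha).mono fun y hy => by simpa [vOpenBall, hy] using h)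
    · exact Or.inr ((eventually_val_sub ha).mono fun y hy => by simpa [vOpenBall, hy] using h)
  · by_cases ha : a = 0
    · induction γ using WithTop.recTopCoe with
      | top => exact Or.inr (eventually_ne_zero.mono fun y hy => by
          simpa [ha, vClosedBall] using hy)
      | coe γ => exact Or.inl ((eventually_gamma_lt hv γ).mono fun y hy => by
          simpa [ha, vClosedBall] using hy.le)
    by_cases h : (γ : WithTop Γ) ≤ v a
    · exact Or.inl ((eventually_val_sub ha).mono fun y hy => by simpa [vClosedBall, hy] using h)
    · exact Or.inr ((eventually_val_sub ha).mono fun y hy => by simpa [vClosedBall, hy] using h)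

/-- A ball is open and closed, unless it is a point. -/
theorem IsVBall.locally_const (hv : Function.Surjective v) {B : Set K} (hB : IsVBall v B) :
    ∃ p, ∀ x, x ≠ p → ∀ᶠ y in nz v, (x + y ∈ B ↔ x ∈ B) := by
  rcases hB with (rfl | ⟨a, γ, rfl⟩) | ⟨a, γ, rfl⟩
  · simp
  · refine ⟨0, fun x _ => (eventually_gamma_lt hv γ).mono fun y hy => ?_⟩
    exact ⟨fun h => lt_val_sub_trans (y := x + y) (by simpa using hy) h,
      fun h => lt_val_sub_trans (y := x) (by simpa using hy) h⟩
  · refine ⟨a, fun x hx => ?_⟩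
    have hx' : x - a ≠ 0 := sub_ne_zero.2 hx
    refine (eventually_lt_val hx').mono fun y hy => ?_
    have : v (x + y - a) = v (x - a) := by
      rw [add_sub_right_comm]
      exact v.map_add_eq_of_lt_left hy
    simp [vClosedBall, this]

/-- A ball contains the closed ball around `a` of radius `v c`, or meets it inside a single residue
class. -/
theorem IsVBall.subset_class_or {B : Set K} (hB : IsVBall v B) (a c : K) :
    ∃ t, (∀ x ∈ B, v c ≤ v (x - a) → v c < v (x - t)) ∨ ∀ x, v c ≤ v (x - a) → x ∈ B := by
  by_cases hne : ∃ x ∈ B, v c ≤ v (x - a)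
  swap
  · push Not at hne
    exact ⟨0, Or.inl fun x hx h => absurd h (hne x hx).not_ge⟩
  obtain ⟨x₀, hx₀, hx₀'⟩ := hne
  have hsub : ∀ x, v c ≤ v (x - a) → v c ≤ v (x - x₀) := fun x hx =>
    le_val_sub_trans hx (le_val_sub_comm hx₀')
  rcases hB with (rfl | ⟨b, γ, rfl⟩) | ⟨b, γ, rfl⟩
  · exact ⟨0, Or.inr fun x _ => trivial⟩
  · rcases lt_or_ge (γ : WithTop Γ) (v c) with h | h
    · exact ⟨0, Or.inr fun x hx => lt_val_sub_trans (h.trans_le (hsub x hx)) hx₀⟩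
    · exact ⟨b, Or.inl fun x hx _ => h.trans_lt hx⟩
  · rcases le_or_gt γ (v c) with h | h
    · exact ⟨0, Or.inr fun x hx => le_val_sub_trans (h.trans (hsub x hx)) hx₀⟩
    · exact ⟨b, Or.inl fun x hx _ => h.trans_le hx⟩

variable (v) in
/-- The part of `{x | P x}` in the closed ball around `a` of radius `v c` is covered by the residue
classes, that is the open balls of radius `v c`, of the elements of `T`. -/
def CoveredBy (a c : K) (T : Finset K) (P : K → Prop) : Prop :=
  ∀ x, v c ≤ v (x - a) → P x → ∃ t ∈ T, v c < v (x - t)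

/-- In a closed ball, a set described by `N` balls, or its complement, is covered by `N` residue
classes: outside the classes met by those of the `N` balls that do not contain the closed ball,
membership is constant. -/
theorem BallDet.covered {N : ℕ} {S : Set K} (hS : BallDet v N S) (a c : K) :
    (∃ T : Finset K, T.card ≤ N ∧ CoveredBy v a c T (· ∈ S)) ∨
      ∃ T : Finset K, T.card ≤ N ∧ CoveredBy v a c T (· ∉ S) := by
  classical
  obtain ⟨D, hD, hball, hdet⟩ := hS
  have : ∀ B : Set K, ∃ t, B ∈ D → (∀ x ∈ B, v c ≤ v (x - a) → v c < v (x - t)) ∨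
      ∀ x, v c ≤ v (x - a) → x ∈ B := fun B => by
    by_cases hB : B ∈ D
    · exact ((hball B hB).subset_class_or a c).imp fun t ht _ => ht
    · exact ⟨0, fun h => (hB h).elim⟩
  choose t ht using this
  have hcard : (D.image t).card ≤ N := Finset.card_image_le.trans hD
  have hsame : ∀ x y, v c ≤ v (x - a) → v c ≤ v (y - a) →
      (¬ ∃ s ∈ D.image t, v c < v (x - s)) → (¬ ∃ s ∈ D.image t, v c < v (y - s)) →
      (x ∈ S ↔ y ∈ S) := by
    refine fun x y hx hy hx' hy' => hdet x y fun B hB => ?_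
    rcases ht B hB with h | h
    · exact iff_of_false (fun h' => hx' ⟨t B, Finset.mem_image_of_mem _ hB, h x h' hx⟩)
        fun h' => hy' ⟨t B, Finset.mem_image_of_mem _ hB, h y h' hy⟩
    · exact iff_of_true (h x hx) (h y hy)
  by_cases h : CoveredBy v a c (D.image t) (· ∈ S)
  · exact Or.inl ⟨_, hcard, h⟩
  · refine Or.inr ⟨_, hcard, fun y hy hyS => ?_⟩
    unfold CoveredBy at h
    push Not at h
    obtain ⟨x, hx, hxS, hx'⟩ := h
    by_contra hy'
    exact hyS ((hsame x y hx hy (by push Not; exact hx') hy').1 hxS)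

/-- The union of a chain of sets, each of which is covered by at most `N` residue classes, is
covered by finitely many residue classes. -/
theorem exists_coveredBy_chain {κ : Type*} {P : κ → K → Prop} {a c : K} (hc : c ≠ 0)
    (N : ℕ)
    (hchain : ∀ i j, (∀ x, P i x → P j x) ∨ ∀ x, P j x → P i x)
    (h : ∀ i, ∃ T : Finset K, T.card ≤ N ∧ CoveredBy v a c T (P i)) :
    ∃ T : Finset K, CoveredBy v a c T fun x => ∃ i, P i x := by
  classical
  by_cases hne : Nonempty κ
  swap
  · exact ⟨∅, fun x _ ⟨i, _⟩ => (hne ⟨i⟩).elim⟩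
  -- A separated subset, of maximal size, of a member of the chain meets every class in
  -- question.
  let Sep : Finset K → Prop := fun T => (∀ x ∈ T, v c ≤ v (x - a)) ∧
    (∀ x ∈ T, ∀ y ∈ T, v c < v (x - y) → x = y) ∧ ∃ i, ∀ x ∈ T, P i x
  have hbound : ∀ T, Sep T → T.card ≤ N := by
    rintro T ⟨h1, h2, i, h3⟩
    obtain ⟨U, hU, hcov⟩ := h i
    have : ∀ x : K, ∃ t, x ∈ T → t ∈ U ∧ v c < v (x - t) := fun x => by
      by_cases hx : x ∈ T
      · exact (hcov x (h1 x hx) (h3 x hx)).imp fun t ht _ => ht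
      · exact ⟨0, fun h => (hx h).elim⟩
    choose g hg using this
    refine (Finset.card_le_card_of_injOn g (fun x hx => (hg x hx).1) fun x hx y hy hxy => ?_).trans
      hU
    exact h2 x hx y hy (lt_val_sub_trans (hg x hx).2 (lt_val_sub_comm (hxy ▸ (hg y hy).2)))
  have hex : ∃ n, ∃ T, Sep T ∧ T.card = n :=
    ⟨0, ∅, ⟨by simp, by simp, hne.some, by simp⟩, rfl⟩
  obtain ⟨T, hT, hTn⟩ := Nat.findGreatest_spec (P := fun n => ∃ T, Sep T ∧ T.card = n)
    (Nat.zero_le N) ⟨∅, ⟨by simp, by simp, hne.some, by simp⟩, rfl⟩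
  have hmax : ∀ U, Sep U → U.card ≤ T.card := fun U hU =>
    hTn ▸ Nat.le_findGreatest (hbound U hU) ⟨U, hU, rfl⟩
  refine ⟨T, fun x hx ⟨j, hj⟩ => ?_⟩
  by_contra! hcon
  obtain ⟨h1, h2, i, h3⟩ := hT
  have hxT : x ∉ T := fun hxT => absurd (hcon x hxT) (not_le.2 (by simpa using val_lt_top hc))
  have : Sep (insert x T) := by
    refine ⟨?_, ?_, ?_⟩
    · simpa [hx] using h1
    · intro y hy z hz hyz
      rcases Finset.mem_insert.1 hy with rfl | hy <;> rcases Finset.mem_insert.1 hz with rfl | hz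
      · rfl
      · exact absurd hyz (hcon z hz).not_gt
      · exact absurd (lt_val_sub_comm hyz) (hcon y ‹_›).not_gt
      · exact h2 y hy z hz hyz
    · rcases hchain i j with hij | hij
      · exact ⟨j, by simpa [hj] using fun y hy => hij y (h3 y hy)⟩
      · exact ⟨i, by simpa [hij x hj] using h3⟩
  have := hmax _ this
  rw [Finset.card_insert_of_notMem hxT] at this
  omega

end Balls

/-! ### Definable sets and families in a uniformly `C`-minimal field -/

section CMin

open Filter

variable (L : FirstOrder.Language) {K Γ : Type*} [L.Structure K] [Field K]
  [AddCommGroup Γ] [LinearOrder Γ] [IsOrderedAddMonoid Γ]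

/-- In every definable family of subsets of `K`, all members are described by a bounded number of
balls. -/
class UniformBalls (v : AddValuation K (WithTop Γ)) : Prop where
  bound : ∀ {α : Type} (P : (α → K) → K → Prop),
    Dfn L (fun z : Option α → K => P (fun i => z (some i)) (z none)) →
      ∃ N, ∀ z, BallDet v N {x | P z x}

variable {v : AddValuation K (WithTop Γ)} [hV : DfnVal L v] [hU : UniformBalls L v]

omit hV in
include hU in
theorem exists_ballDet (P : K → Prop) [hP : Dfn₁ L P] : ∃ N, BallDet v N {x | P x} := by
  have : Dfn L fun z : Option Empty → K => P (z none) := inferInstance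
  obtain ⟨N, hN⟩ := hU.bound (fun _ : Empty → K => P) this
  exact ⟨N, hN Empty.elim⟩

include hV hU in
/-- A definable property holds either throughout a punctured neighbourhood of `0` or nowhere in
it. -/
theorem eventually_or (P : K → Prop) [Dfn₁ L P] :
    (∀ᶠ y in nz v, P y) ∨ ∀ᶠ y in nz v, ¬ P y := by
  obtain ⟨N, D, -, hball, hdet⟩ := exists_ballDet L (v := v) P
  have h1 : ∀ᶠ y in nz v, ∀ B ∈ D, y ∈ B ↔ ∀ᶠ t in nz v, t ∈ B := by
    rw [Filter.eventually_all_finset]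
    intro B hB
    rcases (hball B hB).eventually_mem_or hV.surj with h | h
    · exact h.mono fun y hy => iff_of_true hy h
    · by_cases h' : ∀ᶠ t in nz v, t ∈ B
      · exact h'.mono fun y hy => iff_of_true hy h'
      · exact h.mono fun y hy => iff_of_false hy h'
  by_cases h2 : ∃ x, (∀ B ∈ D, x ∈ B ↔ ∀ᶠ t in nz v, t ∈ B) ∧ P x
  · obtain ⟨x, hx, hPx⟩ := h2
    exact Or.inl (h1.mono fun y hy =>
      (hdet x y fun B hB => (hx B hB).trans (hy B hB).symm).1 hPx)
  · exact Or.inr (h1.mono fun y hy hPy => h2 ⟨y, hy, hPy⟩)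

include hV hU in
/-- An infinite definable set contains a ball, as finitely many points apart each of the balls that
describe it is locally constant. -/
theorem exists_ob_subset_of_infinite (P : K → Prop) [Dfn₁ L P] (h : {x | P x}.Infinite) :
    ∃ a c, c ≠ 0 ∧ ∀ x ∈ ob v a c, P x := by
  classical
  obtain ⟨N, D, -, hball, hdet⟩ := exists_ballDet L (v := v) P
  have : ∀ B : Set K, ∃ p, B ∈ D → ∀ x, x ≠ p → ∀ᶠ y in nz v, (x + y ∈ B ↔ x ∈ B) := fun B => by
    by_cases hB : B ∈ D
    · exact ((hball B hB).locally_const hV.surj).imp fun t ht _ => ht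
    · exact ⟨0, fun h => (hB h).elim⟩
  choose p hp using this
  obtain ⟨x, hx, hxp⟩ := h.exists_notMem_finset (D.image p)
  have h1 : ∀ᶠ y in nz v, ∀ B ∈ D, (x + y ∈ B ↔ x ∈ B) := by
    rw [Filter.eventually_all_finset]
    exact fun B hB => hp B hB x fun h => hxp (h ▸ Finset.mem_image_of_mem p hB)
  obtain ⟨c, hc, h2⟩ := eventually_nz.1 h1
  refine ⟨x, c, hc, fun y hy => ?_⟩
  by_cases hyx : y = x
  · exact hyx ▸ hx
  have h3 := h2 (y - x) (sub_ne_zero.2 hyx) hy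
  rw [add_sub_cancel] at h3
  exact (hdet y x h3).2 hx

omit hV in
include hU in
theorem exists_coveredBy_bound {α : Type} (P : (α → K) → K → Prop)
    [hP : Dfn L (fun z : Option α → K => P (fun i => z (some i)) (z none))] :
    ∃ N, ∀ z a c, (∃ T : Finset K, T.card ≤ N ∧ CoveredBy v a c T (P z)) ∨
      ∃ T : Finset K, T.card ≤ N ∧ CoveredBy v a c T fun x => ¬ P z x :=
  (hU.bound P hP).imp fun _ hN z a c => (hN z).covered a c

variable [IsAlgClosed K]

omit hV hU [L.Structure K] in
theorem CoveredBy.ne_union {a c : K} (hc : c ≠ 0) {T U : Finset K} {P Q : K → Prop}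
    (hP : CoveredBy v a c T P) (hQ : CoveredBy v a c U Q) :
    ∃ x, v c ≤ v (x - a) ∧ ¬ P x ∧ ¬ Q x := by
  classical
  obtain ⟨x, hx, hx'⟩ := exists_residue (v := v) (T ∪ U) a hc
  refine ⟨x, hx, fun h => ?_, fun h => ?_⟩
  · obtain ⟨t, ht, h⟩ := hP x hx h
    exact hx' t (Finset.mem_union_left _ ht) h
  · obtain ⟨t, ht, h⟩ := hQ x hx h
    exact hx' t (Finset.mem_union_right _ ht) h

omit hV hU [L.Structure K] in
/-- Outside the given residue classes there is a further one. -/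
theorem CoveredBy.exists_ob {a c : K} (hc : c ≠ 0) {T : Finset K} {Q : K → Prop}
    (hT : CoveredBy v a c T fun x => ¬ Q x) :
    ∃ b, v c ≤ v (b - a) ∧ ∀ x ∈ ob v b c, Q x := by
  obtain ⟨b, hb, hb'⟩ := exists_residue (v := v) T a hc
  refine ⟨b, hb, fun x hx => ?_⟩
  by_contra hQ
  obtain ⟨t, ht, hxt⟩ := hT x (le_val_sub_trans (le_of_lt hx) hb) hQ
  exact hb' t ht (lt_val_sub_trans (lt_val_sub_comm hx) hxt)

omit hV in
include hU in
/-- If each point `x` of a closed ball satisfies `R x e` for all `e` of large value, then a common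
`e` works for all points of the ball outside finitely many residue classes. -/
theorem exists_uniform (R : K → K → Prop) [Dfn₂ L R]
    (hmono : ∀ x e e', e ≠ 0 → e' ≠ 0 → v e ≤ v e' → R x e → R x e') {a c : K} (hc : c ≠ 0)
    (hR : ∀ x, v c ≤ v (x - a) → ∃ e, e ≠ 0 ∧ R x e) :
    ∃ e, e ≠ 0 ∧ ∃ T, CoveredBy v a c T fun x => ¬ R x e := by
  have : Dfn L fun z : Option (Fin 1) → K => R (z none) (z (some 0)) := inferInstance
  obtain ⟨N, hN⟩ := exists_coveredBy_bound L (v := v) (fun (z : Fin 1 → K) x => R x (z 0))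
  by_contra! hcon
  have hsmall : ∀ e : {e : K // e ≠ 0}, ∃ T : Finset K, T.card ≤ N ∧
      CoveredBy v a c T fun x => R x e := fun e =>
    (hN (fun _ => e) a c).resolve_right fun ⟨T, _, hT⟩ => hcon e e.2 T hT
  obtain ⟨T, hT⟩ := exists_coveredBy_chain (P := fun (e : {e : K // e ≠ 0}) x => R x e) hc N
    (fun i j => (le_total (v i) (v j)).imp (fun h x => hmono x i j i.2 j.2 h)
      fun h x => hmono x j i j.2 i.2 h) hsmall
  obtain ⟨x, hx, hx', -⟩ := hT.ne_union hc hT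
  obtain ⟨e, he, h⟩ := hR x hx
  exact hx' ⟨⟨e, he⟩, h⟩

variable [Nontrivial Γ]

include hV hU in
/-- If each point `x` of a ball satisfies `R x e` for all `e` of large value, then a common `e`
works for all points of a smaller ball. -/
theorem exists_ob_uniform (R : K → K → Prop) [Dfn₂ L R]
    (hmono : ∀ x e e', e ≠ 0 → e' ≠ 0 → v e ≤ v e' → R x e → R x e') {a c : K} (hc : c ≠ 0)
    (hR : ∀ x ∈ ob v a c, ∃ e, e ≠ 0 ∧ R x e) :
    ∃ a' c' e, c' ≠ 0 ∧ e ≠ 0 ∧ ob v a' c' ⊆ ob v a c ∧ ∀ x ∈ ob v a' c', R x e := by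
  obtain ⟨d, hd, hcd⟩ := exists_val_gt hV.surj hc
  obtain ⟨e, he, T, hT⟩ := exists_uniform L R hmono hd fun x hx => hR x (hcd.trans_le hx)
  obtain ⟨b, hb, hb'⟩ := hT.exists_ob hd
  exact ⟨b, d, e, hd, he, ob_subset_ob (hcd.trans_le hb) hcd.le, hb'⟩

include hV hU in
/-- A definable function from a closed ball to the value group is constant outside finitely many
residue classes. -/
theorem exists_coveredBy_ne (d : K → WithTop Γ) [hd : DfnV₁ L v d] (a : K) {c : K} (hc : c ≠ 0) :
    ∃ γ T, CoveredBy v a c T fun x => d x ≠ γ := by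
  classical
  obtain ⟨N, hN⟩ := exists_coveredBy_bound L (v := v) (fun (z : Fin 1 → K) x => d x < v (z 0))
  obtain ⟨N', hN'⟩ := exists_coveredBy_bound L (v := v) (fun (z : Fin 1 → K) x => v (z 0) < d x)
  let I := {e : K // ∃ T : Finset K, T.card ≤ N ∧ CoveredBy v a c T fun x => d x < v e}
  let J := {e : K // ∃ T : Finset K, T.card ≤ N' ∧ CoveredBy v a c T fun x => v e < d x}
  obtain ⟨T, hT⟩ := exists_coveredBy_chain (P := fun (e : I) x => d x < v e) hc N
    (fun i j => (le_total (v i) (v j)).imp (fun h x hx => hx.trans_le h)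
      fun h x hx => hx.trans_le h) fun e => e.2
  obtain ⟨U, hU'⟩ := exists_coveredBy_chain (P := fun (e : J) x => v e < d x) hc N'
    (fun i j => (le_total (v j) (v i)).imp (fun h x hx => h.trans_lt hx)
      fun h x hx => h.trans_lt hx) fun e => e.2
  have hIJ : ∀ e : K, (∃ i : I, i.1 = e) ∨ ∃ j : J, j.1 = e := by
    intro e
    rcases hN (fun _ => e) a c with h | ⟨A, hA, h⟩
    · exact Or.inl ⟨⟨e, h⟩, rfl⟩
    · rcases hN' (fun _ => e) a c with h' | ⟨B, hB, h'⟩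
      · exact Or.inr ⟨⟨e, h'⟩, rfl⟩
      · obtain ⟨x, hx, h1, h2⟩ := h.ne_union hc h'
        rw [not_not] at h1 h2
        exact absurd h1 h2.not_gt
  have hcov : CoveredBy v a c (T ∪ U) fun x =>
      (∃ i : I, d x < v i) ∨ ∃ j : J, v j < d x := by
    rintro x hx (h | h)
    · obtain ⟨t, ht, h⟩ := hT x hx h
      exact ⟨t, Finset.mem_union_left _ ht, h⟩
    · obtain ⟨t, ht, h⟩ := hU' x hx h
      exact ⟨t, Finset.mem_union_right _ ht, h⟩
  obtain ⟨x₀, hx₀, hx₀', -⟩ := hcov.ne_union hc hcov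
  have hle : ∀ x y, ¬ ((∃ i : I, d x < v i) ∨ ∃ j : J, v j < d x) →
      ¬ ((∃ i : I, d y < v i) ∨ ∃ j : J, v j < d y) → d x ≤ d y := by
    intro x y hx hy
    by_contra! hlt
    obtain ⟨e, he, h1, h2⟩ := exists_val_between hV.surj hlt
    rcases hIJ e with ⟨i, rfl⟩ | ⟨j, rfl⟩
    · exact hy (Or.inl ⟨i, h1⟩)
    · exact hx (Or.inr ⟨j, h2⟩)
  refine ⟨d x₀, T ∪ U, fun x hx hne => hcov x hx ?_⟩
  by_contra h
  exact hne (le_antisymm (hle x x₀ h hx₀') (hle x₀ x hx₀' h))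

include hV hU in
/-- A definable function from a ball to the value group is constant on a smaller ball. -/
theorem exists_ob_val_const (d : K → WithTop Γ) [hd : DfnV₁ L v d] (a : K) {c : K} (hc : c ≠ 0) :
    ∃ γ a' c', c' ≠ 0 ∧ ob v a' c' ⊆ ob v a c ∧ ∀ x ∈ ob v a' c', d x = γ := by
  obtain ⟨e, he, hce⟩ := exists_val_gt hV.surj hc
  obtain ⟨γ, T, hT⟩ := exists_coveredBy_ne L d a he
  obtain ⟨b, hb, hb'⟩ := hT.exists_ob he
  exact ⟨γ, b, e, he, ob_subset_ob (hce.trans_le hb) hce.le, hb'⟩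

end CMin

/-! ### Germs of definable functions and their limits -/

section Germs

open Filter

variable {L : FirstOrder.Language} {K Γ : Type*} [L.Structure K] [Field K]
  [AddCommGroup Γ] [LinearOrder Γ] [IsOrderedAddMonoid Γ]
  {v : AddValuation K (WithTop Γ)}

theorem lt_of_nsmul_lt {q : ℕ} {x y : Γ} (h : q • x < q • y) : x < y := by
  by_contra! hle
  exact absurd h (nsmul_le_nsmul_right hle q).not_gt

theorem zsmul_left_cancel_of_pos {p q : ℤ} {x : Γ} (hx : 0 < x) (h : p • x = q • x) : p = q := by
  by_contra hne
  rcases lt_or_gt_of_ne hne with hlt | hlt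
  · exact absurd h (zsmul_lt_zsmul_left hx hlt).ne
  · exact absurd h (zsmul_lt_zsmul_left hx hlt).ne'

theorem eventually_lt_zsmul (hv : Function.Surjective v) {p : ℤ} (hp : 0 < p) (δ : Γ) :
    ∀ᶠ y in nz v, δ < p • val v y := by
  filter_upwards [eventually_gamma_lt hv δ, eventually_gamma_lt hv 0, eventually_ne_zero] with y h1
    h2 h3
  rw [← coe_val h3, WithTop.coe_lt_coe] at h1 h2
  obtain ⟨n, rfl⟩ : ∃ n : ℕ, p = n + 1 := ⟨(p - 1).toNat, by omega⟩
  rw [add_zsmul, one_zsmul, natCast_zsmul]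
  exact h1.trans_le (le_add_of_nonneg_left (nsmul_nonneg h2.le n))

variable [hF : DfnField L K] [hV : DfnVal L v] [hU : UniformBalls L v] [IsAlgClosed K]
  [Nontrivial Γ]

include hF hV hU in
/-- Near `0`, a definable function to the value group only depends on the value of the argument. -/
theorem eventually_factors_val (d : K → WithTop Γ) [DfnV₁ L v d] :
    ∀ᶠ y in nz v, ∀ t, v t = v y → d t = d y := by
  classical
  have hgood : ∀ᶠ y in nz v, ∀ t, v y < v (t - y) → d t = d y := by
    refine (eventually_or L (v := v) fun y => ∀ t, v y < v (t - y) → d t = d y).resolve_right ?_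
    intro hbad
    obtain ⟨c, hc, hbad⟩ := eventually_nz.1 hbad
    obtain ⟨e, he, hce⟩ := exists_val_gt hV.surj hc
    obtain ⟨γ, T, hT⟩ := exists_coveredBy_ne L d 0 he
    obtain ⟨x, hx, hxT⟩ := exists_residue (v := v) (insert 0 T) 0 he
    have hx0 := hxT 0 (Finset.mem_insert_self _ _)
    rw [sub_zero] at hx hx0
    have hxe : v x = v e := le_antisymm (not_lt.1 hx0) hx
    have hout : ∀ t, v x ≤ v (t - x) → (∀ s ∈ T, ¬ v e < v (t - s)) → d t = γ := by
      intro t ht hs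
      by_contra hne
      have : v e ≤ v (t - 0) := by
        rw [← hxe]
        exact le_val_sub_trans ht (by simp)
      obtain ⟨s, hs', h⟩ := hT t this hne
      exact hs s hs' h
    have hxT' : ∀ s ∈ T, ¬ v e < v (x - s) := fun s hs => hxT s (Finset.mem_insert_of_mem hs)
    refine hbad x ((AddValuation.ne_top_iff v).1 (hxe ▸ (val_lt_top he).ne)) (hxe ▸ hce) ?_
    intro t ht
    rw [hout x (by simp) hxT', hout t ht.le fun s hs h =>
      hxT' s hs (lt_val_sub_trans (lt_val_sub_comm (hxe ▸ ht)) h)]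
  -- On a sphere near `0` only finitely many values occur, so that one of them is maximal.
  have hmax : ∀ᶠ y in nz v, ∀ t, v t = v y → d t ≤ d y := by
    refine (eventually_or L (v := v) fun y => ∀ t, v t = v y → d t ≤ d y).resolve_right ?_
    intro hbad
    obtain ⟨c, hc, hbad⟩ := eventually_nz.1 (hbad.and hgood)
    obtain ⟨e, he, hce⟩ := exists_val_gt hV.surj hc
    obtain ⟨γ, T, hT⟩ := exists_coveredBy_ne L d 0 he
    have hne : ∀ x, v x = v e → x ≠ 0 := fun x hx =>
      (AddValuation.ne_top_iff v).1 (hx ▸ (val_lt_top he).ne)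
    have hfin : (d '' {x | v x = v e}).Finite := by
      refine (insert γ (T.image d)).finite_toSet.subset ?_
      rintro _ ⟨x, hx, rfl⟩
      by_cases hxγ : d x = γ
      · exact Finset.mem_coe.2 (hxγ ▸ Finset.mem_insert_self _ _)
      · obtain ⟨t, ht, hxt⟩ := hT x (by simpa using hx.ge) hxγ
        have := (hbad x (hne x hx) (hx ▸ hce)).2 t (lt_val_sub_comm (hx ▸ hxt))
        exact Finset.mem_coe.2 (this ▸ Finset.mem_insert_of_mem (Finset.mem_image_of_mem _ ht))
    obtain ⟨_, ⟨x, hx, rfl⟩, hmax⟩ := hfin.exists_maximal ⟨_, e, rfl, rfl⟩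
    refine (hbad x (hne x hx) (hx ▸ hce)).1 fun t ht => ?_
    by_contra! hlt
    exact absurd (hmax ⟨t, ht.trans hx, rfl⟩ hlt.le) hlt.not_ge
  obtain ⟨c, hc, h⟩ := eventually_nz.1 hmax
  refine eventually_nz.2 ⟨c, hc, fun y hy hcy t ht => ?_⟩
  have ht0 : t ≠ 0 := (AddValuation.ne_top_iff v).1 (ht ▸ (val_lt_top hy).ne)
  exact le_antisymm (h y hy hcy t ht) (h t ht0 (ht ▸ hcy) y ht.symm)

include hF hV hU in
/-- Near `0`, a definable function to the value group is a `ℚ`-linear function of the value of the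
argument. -/
theorem eventually_qlinear (hΓ : ∀ g : Γ → Γ, DefinableGammaFun L v g → EventuallyQLinear g)
    (d : K → WithTop Γ) [DfnV₁ L v d] (hd : ∀ᶠ y in nz v, d y ≠ ⊤) :
    ∃ (q : ℕ) (p : ℤ) (κ : Γ), q ≠ 0 ∧
      ∀ᶠ y in nz v, ∃ γ : Γ, d y = γ ∧ q • γ = p • val v y + κ := by
  classical
  obtain ⟨c, hc, h⟩ := eventually_nz.1 ((eventually_factors_val (L := L) d).and hd)
  let g : Γ → Γ := fun γ =>
    if h : ∃ y, v c < v y ∧ v y = γ then (d h.choose).untopD 0 else 0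
  have hg : ∀ y, y ≠ 0 → v c < v y → (g (val v y) : WithTop Γ) = d y := by
    intro y hy hcy
    have hex : ∃ t, v c < v t ∧ v t = (val v y : Γ) := ⟨y, hcy, (coe_val hy).symm⟩
    have h1 : v hex.choose = v y := hex.choose_spec.2.trans (coe_val hy)
    have h2 := (h y hy hcy).1 _ h1
    obtain ⟨γ, hγ⟩ := WithTop.ne_top_iff_exists.1 (h y hy hcy).2
    simp only [g, dif_pos hex, h2, ← hγ, WithTop.untopD_coe]
  have hg' : ∀ y, y ≠ 0 → ¬ v c < v y → g (val v y) = 0 := by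
    intro y hy hcy
    refine dif_neg ?_
    rintro ⟨t, ht, ht'⟩
    exact hcy (by rwa [← coe_val hy, ← ht'])
  have hdef : DefinableGammaFun L v g := by
    have : Dfn L fun z : Fin 2 → K => (z 0 ≠ 0 ∧ z 1 ≠ 0) ∧
        ((v c < v (z 0) ∧ v (z 1) = d (z 0)) ∨ (¬ v c < v (z 0) ∧ v (z 1) = v 1)) := inferInstance
    refine (this.congr fun z => ?_).out
    constructor
    · rintro ⟨γ, h0, h1⟩
      have hz0 : z 0 ≠ 0 := (AddValuation.ne_top_iff v).1 (by simp [h0])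
      have hz1 : z 1 ≠ 0 := (AddValuation.ne_top_iff v).1 (by simp [h1])
      have hγ : γ = val v (z 0) := by simp [val, h0]
      refine ⟨⟨hz0, hz1⟩, ?_⟩
      by_cases hcz : v c < v (z 0)
      · exact Or.inl ⟨hcz, by rw [h1, hγ, hg _ hz0 hcz]⟩
      · exact Or.inr ⟨hcz, by rw [h1, hγ, hg' _ hz0 hcz]; simp⟩
    · rintro ⟨⟨hz0, hz1⟩, ⟨hcz, h1⟩ | ⟨hcz, h1⟩⟩
      · exact ⟨val v (z 0), (coe_val hz0).symm, by rw [h1, hg _ hz0 hcz]⟩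
      · exact ⟨val v (z 0), (coe_val hz0).symm, by rw [h1, hg' _ hz0 hcz]; simp⟩
  obtain ⟨r, α, δ, hlin⟩ := hΓ g hdef
  refine ⟨r.den, r.num, r.den • α, r.den_ne_zero, ?_⟩
  filter_upwards [eventually_gamma_lt hV.surj δ, eventually_lt_val hc, eventually_ne_zero] with y h1
    h2 h3
  rw [← coe_val h3, WithTop.coe_lt_coe] at h1
  refine ⟨g (val v y), (hg y h3 h2).symm, ?_⟩
  rw [← hlin _ h1, nsmul_sub, sub_add_cancel]

include hF hV hU in
/-- Near `0`, a definable function to the value group tends to `+∞`, is constant, or tends to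
`-∞`. -/
theorem eventually_trichotomy (hΓ : ∀ g : Γ → Γ, DefinableGammaFun L v g → EventuallyQLinear g)
    (d : K → WithTop Γ) [DfnV₁ L v d] (hd : ∀ᶠ y in nz v, d y ≠ ⊤) :
    (∀ γ : Γ, ∀ᶠ y in nz v, γ < d y) ∨ (∃ γ : Γ, ∀ᶠ y in nz v, d y = γ) ∨
      ∀ γ : Γ, ∀ᶠ y in nz v, d y < γ := by
  obtain ⟨q, p, κ, hq, h⟩ := eventually_qlinear hΓ d hd
  rcases lt_trichotomy p 0 with hp | rfl | hp
  · refine Or.inr (Or.inr fun γ => ?_)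
    filter_upwards [h, eventually_lt_zsmul hV.surj (neg_pos.2 hp) (κ - q • γ)] with y ⟨δ, hδ, h1⟩ h2
    rw [hδ, WithTop.coe_lt_coe]
    apply lt_of_nsmul_lt (q := q)
    rw [h1]
    rw [neg_zsmul] at h2
    grind
  · refine Or.inr (Or.inl ?_)
    have := nz_neBot hV.surj
    obtain ⟨y₀, γ, -, hγ⟩ := h.exists
    refine ⟨γ, h.mono fun y ⟨δ, hδ, h1⟩ => ?_⟩
    rw [hδ, WithTop.coe_inj]
    exact nsmul_right_injective hq (by simpa using h1.trans (by simpa using hγ.symm))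
  · refine Or.inl fun γ => ?_
    filter_upwards [h, eventually_lt_zsmul hV.surj hp (q • γ - κ)] with y ⟨δ, hδ, h1⟩ h2
    rw [hδ, WithTop.coe_lt_coe]
    apply lt_of_nsmul_lt (q := q)
    rw [h1]
    grind

variable (v) in
/-- `g y` tends to `ℓ` as `y` tends to `0`, for the valuation topology. -/
def VTendsto (g : K → K) (ℓ : K) : Prop := ∀ e, e ≠ 0 → ∀ᶠ y in nz v, v e < v (g y - ℓ)

include hF hV hU in
/-- A definable function that is bounded near `0` has a limit at `0`. Failing a limit, consider the
eventual value `β y` of `v (G y - G z)` for `z` close to `0`. As `G` is bounded, `β` is constant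
near `0` or tends to `+∞`. In the latter case definable completeness provides the limit;
in the former, `G` would take values in infinitely many residue classes of a closed ball, and meet
each class only away from `0`. -/
theorem exists_vtendsto (hΓ : ∀ g : Γ → Γ, DefinableGammaFun L v g → EventuallyQLinear g)
    (hcomplete : IsDefinablyComplete L v) (G : K → K) [hG : DfnF₁ L G] {b : K} (hb : b ≠ 0)
    (hbd : ∀ᶠ y in nz v, v b ≤ v (G y)) : ∃ ℓ, VTendsto v G ℓ := by
  have hne := nz_neBot hV.surj
  by_contra! hno
  have hGne : ∀ y, ∀ᶠ z in nz v, G z ≠ G y := fun y => by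
    refine (eventually_or L (v := v) fun z => G z = G y).resolve_left fun h => hno (G y) ?_
    exact fun e he => h.mono fun z hz => by simpa [hz] using val_lt_top he
  have hβ : ∀ y, ∃ γ : Γ, ∀ᶠ z in nz v, v (G y - G z) = γ := by
    intro y
    rcases eventually_trichotomy hΓ (fun z => v (G y - G z)) ((hGne y).mono fun z hz =>
      (AddValuation.ne_top_iff v).2 (sub_ne_zero.2 hz.symm)) with h | h | h
    · refine (hno (G y) fun e he => ?_).elim
      rw [← coe_val he]
      exact (h _).mono fun z hz => lt_val_sub_comm hz
    · exact h
    · have h0 : ∃ m : K, m ≠ 0 ∧ v m ≤ v (G y) ∧ v m ≤ v b := by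
        by_cases hy : G y = 0
        · exact ⟨b, hb, by simp [hy], le_rfl⟩
        · rcases le_total (v (G y)) (v b) with h | h
          exacts [⟨G y, hy, le_rfl, h⟩, ⟨b, hb, h, le_rfl⟩]
      obtain ⟨m, hm, h1, h2⟩ := h0
      obtain ⟨z, hz, hz'⟩ := ((h (val v m)).and hbd).exists
      rw [coe_val hm] at hz
      exact absurd hz (v.map_le_sub h1 (h2.trans hz')).not_gt
  choose β hβ using hβ
  have hβdef : DfnV₁ L v fun y => (β y : WithTop Γ) := by
    have : Dfn L fun z : Option (Fin 1) → K =>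
        ∀ᶠ t in nz v, v (z none) ≤ v (G (z (some 0)) - G t) := inferInstance
    refine ⟨⟨this.congr fun z => ?_⟩⟩
    refine ⟨fun h => (hβ (z (some 0))).mono fun t ht => ht ▸ h, fun h => ?_⟩
    obtain ⟨t, ht, ht'⟩ := (h.and (hβ (z (some 0)))).exists
    exact ht' ▸ ht
  rcases eventually_trichotomy hΓ (fun y => (β y : WithTop Γ)) (by simp) with h | ⟨γ, h⟩ | h
  · let X : Set ((Fin 1 → K) × K) := {p | (β (p.1 0) : WithTop Γ) ≤ v (p.2 - G (p.1 0))}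
    have hself : ∀ y, (β y : WithTop Γ) ≤ v (G y - G y) := by simp
    have hX : IsDefinableFamily L Set.univ X := by
      refine ⟨Set.definable_univ, ?_, ?_⟩
      · have : DfnV L v fun z : Fin 1 ⊕ Fin 1 → K => (β (z (Sum.inl 0)) : WithTop Γ) := hβdef.comp
        have : Dfn L fun z : Fin 1 ⊕ Fin 1 → K =>
            (β (z (Sum.inl 0)) : WithTop Γ) ≤ v (z (Sum.inr 0) - G (z (Sum.inl 0))) := inferInstance
        exact this.out
      · exact Set.eq_univ_of_forall fun w => ⟨(w, G (w 0)), hself _, rfl⟩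
    obtain ⟨x, hx⟩ := hcomplete 1 Set.univ X hX (fun w _ => Or.inr ⟨G (w 0), β (w 0), rfl⟩)
      (by
        intro w _ w' _
        obtain ⟨z, hz, hz'⟩ := ((hβ (w 0)).and (hβ (w' 0))).exists
        rcases le_total (β (w 0)) (β (w' 0)) with h | h
        · right
          intro x hx
          have hle : (β (w 0) : WithTop Γ) ≤ β (w' 0) := by exact_mod_cast h
          exact le_val_sub_trans (hle.trans hx) (le_val_sub_trans (y := G z) (hz' ▸ hle)
            (le_val_sub_comm hz.ge))
        · left
          intro x hx
          have hle : (β (w' 0) : WithTop Γ) ≤ β (w 0) := by exact_mod_cast h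
          exact le_val_sub_trans (hle.trans hx) (le_val_sub_trans (y := G z) (hz ▸ hle)
            (le_val_sub_comm hz'.ge)))
      fun γ => by
        obtain ⟨y, hy⟩ := (h γ).exists
        exact ⟨fun _ => y, trivial, β y, hy, G y, Or.inl rfl⟩
    refine hno x fun e he => ?_
    rw [← coe_val he]
    exact (h (val v e)).mono fun y hy => hy.trans_le (le_val_sub_comm (hx (fun _ => y) trivial))
  · obtain ⟨e, he, heγ⟩ := exists_val_eq hV.surj γ
    obtain ⟨y₀, hy₀⟩ := h.exists
    have hnot : ∀ x, ∀ᶠ z in nz v, ¬ v e < v (G z - x) := by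
      intro x
      refine (eventually_or L (v := v) fun z => v e < v (G z - x)).resolve_left fun h' => ?_
      obtain ⟨y, hy, hy'⟩ := (h.and h').exists
      obtain ⟨z, hz, hz'⟩ := ((hβ y).and h').exists
      have := lt_val_sub_trans hy' (lt_val_sub_comm hz')
      rw [hz, hy, heγ] at this
      exact lt_irrefl _ this
    obtain ⟨c, hc, T, hT⟩ := exists_uniform L (v := v)
      (fun x c => ∀ z, z ≠ 0 → v c < v z → ¬ v e < v (G z - x))
      (fun x c c' _ _ hcc' h z hz hz' => h z hz (hcc'.trans_lt hz')) (a := G y₀) he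
      fun x _ => eventually_nz.1 (hnot x)
    have hT' : ∀ᶠ z in nz v, ∀ t ∈ T, ¬ v e < v (G z - t) :=
      (Filter.eventually_all_finset T).2 fun t _ => hnot t
    obtain ⟨z, h1, h2, h3, h4⟩ := ((hβ y₀).and (hT'.and
      ((eventually_lt_val hc).and eventually_ne_zero))).exists
    have h5 : v e ≤ v (G z - G y₀) := by
      rw [v.map_sub_swap, h1, heγ]
      exact hy₀.ge
    obtain ⟨t, ht, h6⟩ := hT (G z) h5 fun h => h z h4 h3 (by simpa using val_lt_top he)
    exact h2 t ht h6
  · obtain ⟨c, hc, h1⟩ := eventually_nz.1 hbd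
    obtain ⟨y, hy, hy', hy0⟩ := ((h (val v b)).and ((eventually_lt_val hc).and
      eventually_ne_zero)).exists
    obtain ⟨z, hz, hz'⟩ := ((hβ y).and hbd).exists
    rw [coe_val hb, ← hz] at hy
    exact absurd hy (v.map_le_sub (h1 y hy0 hy') hz').not_gt

end Germs

section Limits

open Filter

variable {L : FirstOrder.Language} {K Γ : Type*} [L.Structure K] [Field K]
  [AddCommGroup Γ] [LinearOrder Γ] [IsOrderedAddMonoid Γ]
  {v : AddValuation K (WithTop Γ)}

theorem eventually_mul_right {P : K → Prop} {u : K} (hu : u ≠ 0) (h : ∀ᶠ y in nz v, P y) :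
    ∀ᶠ y in nz v, P (y * u) := by
  obtain ⟨c, hc, h⟩ := eventually_nz.1 h
  refine eventually_nz.2 ⟨c / u, div_ne_zero hc hu, fun y hy hcy => h _ (mul_ne_zero hy hu) ?_⟩
  rw [val_lt_iff (div_ne_zero hc hu) hy, val_div hc hu] at hcy
  rw [val_lt_iff hc (mul_ne_zero hy hu), val_mul hy hu]
  grind

theorem VTendsto.congr' {g h : K → K} {ℓ : K} (hg : VTendsto v g ℓ)
    (hgh : ∀ᶠ y in nz v, g y = h y) : VTendsto v h ℓ := fun e he =>
  (hg e he).mp (hgh.mono fun _ h1 h2 => h1 ▸ h2)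

theorem vtendsto_const (ℓ : K) : VTendsto v (fun _ => ℓ) ℓ := fun e he =>
  Eventually.of_forall fun _ => by simpa using val_lt_top he

theorem VTendsto.add {g h : K → K} {ℓ m : K} (hg : VTendsto v g ℓ) (hh : VTendsto v h m) :
    VTendsto v (fun y => g y + h y) (ℓ + m) := fun e he => by
  filter_upwards [hg e he, hh e he] with y h1 h2
  rw [add_sub_add_comm]
  exact v.map_lt_add h1 h2

theorem VTendsto.sub {g h : K → K} {ℓ m : K} (hg : VTendsto v g ℓ) (hh : VTendsto v h m) :
    VTendsto v (fun y => g y - h y) (ℓ - m) := fun e he => by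
  filter_upwards [hg e he, hh e he] with y h1 h2
  rw [sub_sub_sub_comm]
  exact lt_val_sub h1 h2

theorem lt_val_mul {e x m : K} (h : m ≠ 0 → v (e / m) < v x) (he : e ≠ 0) : v e < v (x * m) := by
  by_cases hm : m = 0
  · simpa [hm] using val_lt_top he
  by_cases hx : x = 0
  · simpa [hx] using val_lt_top he
  have h := h hm
  rw [val_lt_iff (div_ne_zero he hm) hx, val_div he hm] at h
  rw [val_lt_iff he (mul_ne_zero hx hm), val_mul hx hm]
  grind

theorem VTendsto.mul_const {g : K → K} {ℓ : K} (hg : VTendsto v g ℓ) (m : K) :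
    VTendsto v (fun y => g y * m) (ℓ * m) := fun e he => by
  by_cases hm : m = 0
  · exact Eventually.of_forall fun y => by simpa [hm] using val_lt_top he
  filter_upwards [hg _ (div_ne_zero he hm)] with y h
  rw [← sub_mul]
  exact lt_val_mul (fun _ => h) he

theorem VTendsto.mul {g h : K → K} {ℓ m : K} (hg : VTendsto v g ℓ) (hh : VTendsto v h m) :
    VTendsto v (fun y => g y * h y) (ℓ * m) := by
  have h0 : VTendsto v (fun y => (g y - ℓ) * (h y - m)) 0 := fun e he => by
    filter_upwards [hg e he, hh 1 one_ne_zero] with y h1 h2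
    rw [sub_zero, v.map_mul]
    rw [v.map_one] at h2
    exact h1.trans_le (le_add_of_nonneg_right h2.le)
  have := (h0.add (hg.mul_const m)).add (hh.mul_const ℓ)
  have h2 := this.sub (vtendsto_const (ℓ * m))
  convert h2 using 1
  · funext y
    ring
  · ring

theorem VTendsto.comp_mul {g : K → K} {ℓ u : K} (hg : VTendsto v g ℓ) (hu : u ≠ 0) :
    VTendsto v (fun y => g (y * u)) ℓ := fun e he => eventually_mul_right hu (hg e he)

theorem VTendsto.unique [Nontrivial Γ] (hv : Function.Surjective v) {g : K → K} {ℓ m : K}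
    (h1 : VTendsto v g ℓ) (h2 : VTendsto v g m) : ℓ = m := by
  by_contra hne
  have := nz_neBot hv
  have h0 := sub_ne_zero.2 hne
  obtain ⟨y, hy, hy'⟩ := ((h1 _ h0).and (h2 _ h0)).exists
  exact lt_irrefl _ (lt_val_sub_trans (lt_val_sub_comm hy) hy')

theorem VTendsto.val_eq [Nontrivial Γ] (hv : Function.Surjective v) {g : K → K} {ℓ : K}
    {q : ℕ} (hq : q ≠ 0) {δ : Γ} (h : VTendsto v g ℓ) (hg : ∀ᶠ y in nz v, g y ≠ 0 ∧ q • val v (g y) = δ) :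
    ℓ ≠ 0 ∧ q • val v ℓ = δ := by
  have := nz_neBot hv
  obtain ⟨y₀, hy₀, hy₀'⟩ := hg.exists
  obtain ⟨y, hy, hy', hy''⟩ := ((h _ hy₀).and hg).exists
  have h1 : v (g y₀) = v (g y) :=
    (val_eq_iff hy₀ hy').2 (nsmul_right_injective hq (hy₀'.trans hy''.symm))
  have h2 : v ℓ = v (g y) := v.map_eq_of_lt_sub (h1 ▸ lt_val_sub_comm hy)
  have h3 : ℓ ≠ 0 := (AddValuation.ne_top_iff v).1 (h2 ▸ (val_lt_top hy').ne)
  exact ⟨h3, by rw [(val_eq_iff h3 hy').1 h2, hy'']⟩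

open Classical in
variable (v) in
/-- The limit of `g` at `0`, with the junk value `0` if there is none. -/
noncomputable def vlim (g : K → K) : K := if h : ∃ ℓ, VTendsto v g ℓ then h.choose else 0

theorem vlim_spec {g : K → K} (h : ∃ ℓ, VTendsto v g ℓ) : VTendsto v g (vlim v g) := by
  rw [vlim, dif_pos h]
  exact h.choose_spec

theorem VTendsto.vlim_eq [Nontrivial Γ] (hv : Function.Surjective v) {g : K → K} {ℓ : K}
    (h : VTendsto v g ℓ) :
    vlim v g = ℓ := (vlim_spec ⟨ℓ, h⟩).unique hv h

variable [hF : DfnField L K] [hV : DfnVal L v] [Nontrivial Γ]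

include hF hV in
instance DfnF.vlim {α : Type} {H : (α → K) → K → K}
    [hH : DfnF L fun z : Option α → K => H (fun i => z (some i)) (z none)] :
    DfnF L fun z => vlim v (H z) := by
  have hH1 : DfnF L fun z : Option (Option (Option α)) → K =>
      H (fun i => z (some (some (some i)))) (z none) := hH.comap fun o => o.map (some ∘ some)
  have hH2 : DfnF L fun z : Option (Option (Option (Option α))) → K =>
      H (fun i => z (some (some (some (some i))))) (z none) :=
    hH.comap fun o => o.map (some ∘ some ∘ some)
  refine dfnF_of_graph (P := fun z x => (∀ e, e ≠ 0 → ∀ᶠ y in nz v, v e < v (H z y - x)) ∨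
    ((¬ ∃ ℓ, ∀ e, e ≠ 0 → ∀ᶠ y in nz v, v e < v (H z y - ℓ)) ∧ x = 0)) (fun z x => ?_)
    inferInstance
  constructor
  · rintro rfl
    by_cases h : ∃ ℓ, VTendsto v (H z) ℓ
    · exact Or.inl (vlim_spec h)
    · exact Or.inr ⟨h, dif_neg h⟩
  · rintro (h | ⟨h, rfl⟩)
    · exact VTendsto.vlim_eq hV.surj h
    · exact dif_neg h

variable [hU : UniformBalls L v] [IsAlgClosed K]

include hF hV hU in
/-- A definable function whose value is constant near `0` has a limit, of the same value. -/
theorem vtendsto_vlim (hΓ : ∀ g : Γ → Γ, DefinableGammaFun L v g → EventuallyQLinear g)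
    (hcomplete : IsDefinablyComplete L v) (g : K → K) [DfnF₁ L g] {q : ℕ} (hq : q ≠ 0) {δ : Γ}
    (hg : ∀ᶠ y in nz v, g y ≠ 0 ∧ q • val v (g y) = δ) :
    VTendsto v g (vlim v g) ∧ vlim v g ≠ 0 ∧ q • val v (vlim v g) = δ := by
  have := nz_neBot hV.surj
  obtain ⟨y₀, hy₀, hy₀'⟩ := hg.exists
  have h := vlim_spec (exists_vtendsto hΓ hcomplete g hy₀ (hg.mono fun y hy =>
    ((val_eq_iff hy₀ hy.1).2 (nsmul_right_injective hq (hy₀'.trans hy.2.symm))).le))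
  exact ⟨h, h.val_eq hV.surj hq hg⟩

end Limits

/-! ### Definable functions with constant slope -/

section Slope

open Filter

variable {L : FirstOrder.Language} {K Γ : Type*} [L.Structure K] [Field K]
  [AddCommGroup Γ] [LinearOrder Γ] [IsOrderedAddMonoid Γ] [Nontrivial Γ]
  {v : AddValuation K (WithTop Γ)} [hF : DfnField L K] [hV : DfnVal L v] [hU : UniformBalls L v]
  [IsAlgClosed K]

include hF hV hU in
/-- Blowing up at `0` a definable function of slope `p / q` gives a multiplicative one: the limit
of `f (y * u) / f y` for `y → 0`. -/
theorem exists_multiplicative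
    (hΓ : ∀ g : Γ → Γ, DefinableGammaFun L v g → EventuallyQLinear g)
    (hcomplete : IsDefinablyComplete L v) (f : K → K) [DfnF₁ L f] (hf0 : f 0 = 0)
    {c : K} (hc : c ≠ 0) {q : ℕ} (hq : q ≠ 0) {p : ℤ} {κ : Γ}
    (hf : ∀ s t, v c < v s → v c < v t → s ≠ t →
      f s - f t ≠ 0 ∧ q • val v (f s - f t) = p • val v (s - t) + κ) :
    ∃ M : K → K, DfnF₁ L M ∧ M 1 = 1 ∧ (∀ u u', u ≠ 0 → u' ≠ 0 → M (u * u') = M u * M u') ∧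
      ∀ u u', u ≠ 0 → u' ≠ 0 → u ≠ u' →
        M u - M u' ≠ 0 ∧ q • val v (M u - M u') = p • val v (u - u') := by
  have hne := nz_neBot hV.surj
  have hf' : ∀ y, y ≠ 0 → v c < v y → f y ≠ 0 ∧ q • val v (f y) = p • val v y + κ := by
    intro y hy hcy
    simpa [hf0] using hf y 0 hcy (by simpa using val_lt_top hc) hy
  have hdiff : ∀ u u', u ≠ 0 → u' ≠ 0 → u ≠ u' → ∀ᶠ y in nz v,
      (f (y * u) - f (y * u')) / f y ≠ 0 ∧
        q • val v ((f (y * u) - f (y * u')) / f y) = p • val v (u - u') := by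
    intro u u' hu hu' huu'
    filter_upwards [eventually_mul_right hu (eventually_lt_val hc),
      eventually_mul_right hu' (eventually_lt_val hc), eventually_lt_val hc, eventually_ne_zero]
      with y h1 h2 h3 hy
    have h4 := hf _ _ h1 h2 fun h => huu' (mul_left_cancel₀ hy h)
    have h5 := hf' y hy h3
    refine ⟨div_ne_zero h4.1 h5.1, ?_⟩
    rw [val_div h4.1 h5.1, nsmul_sub, h4.2, h5.2, ← mul_sub, val_mul hy (sub_ne_zero.2 huu'),
      zsmul_add]
    abel
  have hlim : ∀ u, u ≠ 0 → VTendsto v (fun y => f (y * u) / f y)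
      (vlim v fun y => f (y * u) / f y) ∧ vlim v (fun y => f (y * u) / f y) ≠ 0 := by
    intro u hu
    have h := vtendsto_vlim (L := L) hΓ hcomplete (fun y => f (y * u) / f y) hq
      (δ := p • val v u) (by
      filter_upwards [eventually_mul_right hu (eventually_lt_val hc), eventually_lt_val hc,
        eventually_ne_zero] with y h1 h3 hy
      have h4 := hf' _ (mul_ne_zero hy hu) h1
      have h5 := hf' y hy h3
      refine ⟨div_ne_zero h4.1 h5.1, ?_⟩
      rw [val_div h4.1 h5.1, nsmul_sub, h4.2, h5.2, val_mul hy hu, zsmul_add]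
      abel)
    exact ⟨h.1, h.2.1⟩
  refine ⟨fun u => vlim v fun y => f (y * u) / f y, inferInstance, ?_, ?_, ?_⟩
  · refine ((vtendsto_const 1).congr' ?_).vlim_eq hV.surj
    filter_upwards [eventually_lt_val hc, eventually_ne_zero] with y h1 hy
    rw [mul_one, div_self (hf' y hy h1).1]
  · intro u u' hu hu'
    refine ((((hlim u hu).1.comp_mul hu').mul (hlim u' hu').1).congr' ?_).vlim_eq hV.surj
    filter_upwards [eventually_mul_right hu' (eventually_lt_val hc), eventually_ne_zero]
      with y h1 hy
    have := (hf' _ (mul_ne_zero hy hu') h1).1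
    rw [div_mul_div_cancel₀ this, mul_assoc, mul_comm u' u]
  · intro u u' hu hu' huu'
    refine ((hlim u hu).1.sub (hlim u' hu').1).val_eq hV.surj hq ?_
    simpa only [sub_div] using hdiff u u' hu hu' huu'

include hF hV hU in
/-- Blowing up at `1` a definable multiplicative function of slope `p / q` gives an additive one:
the limit of `(M (1 + y * u) - 1) / (M (1 + y) - 1)` for `y → 0`. -/
theorem exists_additive
    (hΓ : ∀ g : Γ → Γ, DefinableGammaFun L v g → EventuallyQLinear g)
    (hcomplete : IsDefinablyComplete L v) (M : K → K) [DfnF₁ L M] (hM1 : M 1 = 1)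
    (hmul : ∀ u u', u ≠ 0 → u' ≠ 0 → M (u * u') = M u * M u')
    {q : ℕ} (hq : q ≠ 0) {p : ℤ} (hp : 0 < p)
    (hM : ∀ u u', u ≠ 0 → u' ≠ 0 → u ≠ u' →
      M u - M u' ≠ 0 ∧ q • val v (M u - M u') = p • val v (u - u')) :
    ∃ A : K → K, DfnF₁ L A ∧ A 1 = 1 ∧ A 0 = 0 ∧ (∀ u u', A (u + u') = A u + A u') ∧
      ∀ u, u ≠ 0 → q • val v (A u) = p • val v u := by
  have hone : ∀ u, ∀ᶠ y in nz v, 1 + y * u ≠ 0 := by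
    intro u
    by_cases hu : u = 0
    · simp [hu]
    filter_upwards [eventually_mul_right hu (eventually_lt_val one_ne_zero)] with y hy h
    rw [← neg_eq_iff_add_eq_zero.2 h, v.map_neg] at hy
    exact lt_irrefl _ hy
  have hnum : ∀ u, u ≠ 0 → ∀ᶠ y in nz v, M (1 + y * u) - 1 ≠ 0 ∧
      q • val v (M (1 + y * u) - 1) = p • val v (y * u) := by
    intro u hu
    filter_upwards [hone u, eventually_ne_zero] with y h1 hy
    have := hM _ 1 h1 one_ne_zero (by simp [hy, hu])
    rwa [hM1, add_sub_cancel_left] at this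
  have hden : ∀ᶠ y in nz v, M (1 + y) - 1 ≠ 0 ∧ q • val v (M (1 + y) - 1) = p • val v y := by
    simpa using hnum 1 one_ne_zero
  have hlim : ∀ u, u ≠ 0 → VTendsto v (fun y => (M (1 + y * u) - 1) / (M (1 + y) - 1))
      (vlim v fun y => (M (1 + y * u) - 1) / (M (1 + y) - 1)) ∧
      q • val v (vlim v fun y => (M (1 + y * u) - 1) / (M (1 + y) - 1)) = p • val v u := by
    intro u hu
    have h := vtendsto_vlim (L := L) hΓ hcomplete
      (fun y => (M (1 + y * u) - 1) / (M (1 + y) - 1)) hq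
      (δ := p • val v u) (by
        filter_upwards [hnum u hu, hden, eventually_ne_zero] with y h1 h2 hy
        refine ⟨div_ne_zero h1.1 h2.1, ?_⟩
        rw [val_div h1.1 h2.1, nsmul_sub, h1.2, h2.2, val_mul hy hu, zsmul_add]
        abel)
    exact ⟨h.1, h.2.2⟩
  have hzero : vlim v (fun y => (M (1 + y * 0) - 1) / (M (1 + y) - 1)) = 0 :=
    ((vtendsto_const 0).congr' (by simp [hM1])).vlim_eq hV.surj
  refine ⟨fun u => vlim v fun y => (M (1 + y * u) - 1) / (M (1 + y) - 1), inferInstance, ?_, hzero,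
    ?_, fun u hu => (hlim u hu).2⟩
  · refine ((vtendsto_const 1).congr' ?_).vlim_eq hV.surj
    filter_upwards [hden] with y hy
    rw [mul_one, div_self hy.1]
  · intro u u'
    beta_reduce
    by_cases hu : u = 0
    · rw [hu, zero_add, hzero, zero_add]
    by_cases hu' : u' = 0
    · rw [hu', add_zero, hzero, add_zero]
    have h0 : VTendsto v (fun y => M (1 + y * u') - 1) 0 := by
      intro e he
      filter_upwards [hnum u' hu', eventually_mul_right hu'
        (eventually_lt_zsmul hV.surj hp (q • val v e))] with y h1 h2
      rw [sub_zero, val_lt_iff he h1.1]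
      exact lt_of_nsmul_lt (h1.2 ▸ h2)
    -- `M (1 + y * u) * M (1 + y * u')` differs from `M (1 + y * (u + u'))` by a quantity of
    -- higher order, as `(1 + y * u) * (1 + y * u')` and `1 + y * (u + u')` differ by
    -- `y ^ 2 * u * u'`.
    have h1 : VTendsto v (fun y => (M (1 + y * (u + u')) - M (1 + y * u) * M (1 + y * u')) /
        (M (1 + y) - 1)) 0 := by
      intro e he
      filter_upwards [hone u, hone u', hone (u + u'), hden, eventually_ne_zero,
        eventually_lt_zsmul hV.surj hp (q • val v e - p • val v (u * u'))] with y h1 h2 h3 h4 hy h5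
      have huu := mul_ne_zero hu hu'
      have hyy := mul_ne_zero hy hy
      have h6 : 1 + y * (u + u') - (1 + y * u) * (1 + y * u') = -((y * y) * (u * u')) := by ring
      have h7 := hM _ _ h3 (mul_ne_zero h1 h2) (sub_ne_zero.1 (by
        rw [h6]
        exact neg_ne_zero.2 (mul_ne_zero hyy huu)))
      rw [hmul _ _ h1 h2, h6, val_neg, val_mul hyy huu, val_mul hy hy, zsmul_add, zsmul_add] at h7
      rw [sub_zero, val_lt_iff he (div_ne_zero h7.1 h4.1), val_div h7.1 h4.1]
      apply lt_of_nsmul_lt (q := q)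
      rw [nsmul_sub, h7.2, h4.2]
      grind
    have h2 := (((hlim u hu).1.add (hlim u' hu').1).add ((hlim u hu).1.mul h0)).add h1
    rw [mul_zero, add_zero, add_zero] at h2
    refine VTendsto.vlim_eq hV.surj (h2.congr' (Eventually.of_forall fun y => ?_))
    ring

include hF hV hU in
/-- The slope of a definable function is `1`. In characteristic zero, blowing up twice yields a
definable additive function of the same slope that fixes the natural numbers; its set of fixed
points is infinite, so that it contains a ball. -/
theorem slope_eq_one [CharZero K]
    (hΓ : ∀ g : Γ → Γ, DefinableGammaFun L v g → EventuallyQLinear g)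
    (hcomplete : IsDefinablyComplete L v) (G : K → K) [DfnF₁ L G] (a : K) {c : K} (hc : c ≠ 0)
    {q : ℕ} (hq : q ≠ 0) {p : ℤ} {κ : Γ}
    (hG : ∀ x ∈ ob v a c, ∀ y ∈ ob v a c, x ≠ y →
      G x - G y ≠ 0 ∧ q • val v (G x - G y) = p • val v (x - y) + κ) : p = q := by
  have hne := nz_neBot hV.surj
  have hp : 0 < p := by
    have hinj : Set.InjOn G (ob v a c) := fun x hx y hy hxy => by
      by_contra h
      exact (hG x hx y hy h).1 (sub_eq_zero.2 hxy)
    have hset : {u | ∃ x, v c < v (x - a) ∧ G x = u} = G '' ob v a c := rfl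
    have hinf : {u | ∃ x, v c < v (x - a) ∧ G x = u}.Infinite :=
      hset ▸ (ob_infinite hV.surj a hc).image hinj
    obtain ⟨b, e, he, hsub⟩ := exists_ob_subset_of_infinite L (v := v)
      (fun u => ∃ x, v c < v (x - a) ∧ G x = u) hinf
    obtain ⟨x₀, hx₀, hb⟩ := hsub b (mem_ob_self he)
    by_contra! hp
    obtain ⟨t, ht, ht0, ht'⟩ := ((eventually_mem_ob (v := v) (a := b) he).and
      (eventually_ne_zero.and (eventually_lt_zsmul (v := v) hV.surj (p := q) (by omega)
        (p • val v c + κ)))).exists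
    obtain ⟨x, hx, hxt⟩ := hsub _ ht
    have hxx : x ≠ x₀ := by
      rintro rfl
      exact ht0 (by rw [hb] at hxt; simpa using hxt.symm)
    have h1 := (hG x hx x₀ hx₀ hxx).2
    rw [hxt, hb, add_sub_cancel_left] at h1
    have h2 : val v c ≤ val v (x - x₀) :=
      (val_le_iff hc (sub_ne_zero.2 hxx)).1 (sub_mem_of_mem_ob hx hx₀).le
    have h3 := zsmul_le_zsmul_right (neg_nonneg.2 hp) h2
    rw [neg_zsmul, neg_zsmul] at h3
    rw [natCast_zsmul, h1] at ht'
    grind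
  have hf : ∀ s t, v c < v s → v c < v t → s ≠ t →
      (G (a + s) - G a) - (G (a + t) - G a) ≠ 0 ∧
        q • val v ((G (a + s) - G a) - (G (a + t) - G a)) = p • val v (s - t) + κ := by
    intro s t hs ht hst
    have := hG (a + s) (by simpa [mem_ob] using hs) (a + t) (by simpa [mem_ob] using ht)
      (by simpa using hst)
    rw [add_sub_add_left_eq_sub] at this
    rwa [sub_sub_sub_cancel_right]
  obtain ⟨M, hM, hM1, hmul, hMval⟩ := exists_multiplicative (L := L) hΓ hcomplete
    (fun t => G (a + t) - G a) (by simp) hc hq hf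
  obtain ⟨A, hA, hA1, hA0, hadd, hAval⟩ := exists_additive (L := L) hΓ hcomplete M hM1 hmul hq hp
    hMval
  have hnat : ∀ n : ℕ, A n = n := by
    intro n
    induction n with
    | zero => simpa using hA0
    | succ n ih => rw [Nat.cast_succ, hadd, ih, hA1]
  obtain ⟨b, e, he, hfix⟩ := exists_ob_subset_of_infinite L (v := v) (fun u => A u = u)
    (Set.infinite_of_injective_forall_mem Nat.cast_injective hnat)
  obtain ⟨t, ht, ht0, ht'⟩ := ((eventually_mem_ob (v := v) (a := b) he).and
    (eventually_ne_zero.and (eventually_gamma_lt hV.surj 0))).exists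
  have h1 : A t = t := by
    have := hfix _ ht
    rwa [hadd, hfix b (mem_ob_self he), add_right_inj] at this
  have h2 := hAval t ht0
  rw [h1, ← natCast_zsmul] at h2
  rw [← coe_val ht0, WithTop.coe_lt_coe] at ht'
  exact (zsmul_left_cancel_of_pos ht' h2).symm

end Slope

section Isometry

open Filter

variable {L : FirstOrder.Language} {K Γ : Type*} [L.Structure K] [Field K]
  [AddCommGroup Γ] [LinearOrder Γ] [IsOrderedAddMonoid Γ] [Nontrivial Γ]
  {v : AddValuation K (WithTop Γ)}

omit [Nontrivial Γ] in
theorem exists_val_max {c d : K} (hc : c ≠ 0) (hd : d ≠ 0) :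
    ∃ e, e ≠ 0 ∧ v c ≤ v e ∧ v d ≤ v e := by
  rcases le_total (v c) (v d) with h | h
  exacts [⟨d, hd, h, le_rfl⟩, ⟨c, hc, le_rfl, h⟩]

/-- A function `D` which turns multiplicative relations between values into such relations, and has
a slope near `0`, has this slope throughout. -/
theorem exists_slope (hv : Function.Surjective v) {D : K → K} {e y₀ : K} (hy₀ : y₀ ≠ 0)
    (hey₀ : v e < v y₀)
    (hD0 : ∀ y, y ≠ 0 → v e < v y → D y ≠ 0)
    (hD : ∀ y₁ y₂ y₃ y₄, (y₁ ≠ 0 ∧ v e < v y₁) → (y₂ ≠ 0 ∧ v e < v y₂) → (y₃ ≠ 0 ∧ v e < v y₃) →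
      (y₄ ≠ 0 ∧ v e < v y₄) → v (y₁ * y₂) = v (y₃ * y₄) → v (D y₁ * D y₂) = v (D y₃ * D y₄))
    {q : ℕ} {p : ℤ} {κ : Γ} (hlin : ∀ᶠ y in nz v, ∃ γ : Γ, v (D y) = γ ∧ q • γ = p • val v y + κ)
    (y : K) (hy : y ≠ 0) (hey : v e < v y) :
    q • (val v (D y) - val v (D y₀)) = p • (val v y - val v y₀) := by
  have := nz_neBot hv
  have he : e ≠ 0 := (AddValuation.ne_top_iff v).1 hey.ne_top
  have hu : y / y₀ ≠ 0 := div_ne_zero hy hy₀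
  have hnear := (hlin.and (eventually_lt_val he)).and eventually_ne_zero
  obtain ⟨z, ⟨⟨⟨γ, h1, h1'⟩, h2⟩, hz⟩, ⟨⟨δ, h3, h3'⟩, h4⟩, hz'⟩ :=
    (hnear.and (eventually_mul_right hu hnear)).exists
  have h5 := hD y z y₀ (z * (y / y₀)) ⟨hy, hey⟩ ⟨hz, h2⟩ ⟨hy₀, hey₀⟩ ⟨hz', h4⟩ (by
    congr 1
    field_simp)
  have d1 := hD0 y hy hey
  have d2 := hD0 z hz h2
  have d3 := hD0 y₀ hy₀ hey₀
  have d4 := hD0 _ hz' h4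
  rw [val_eq_iff (mul_ne_zero d1 d2) (mul_ne_zero d3 d4), val_mul d1 d2, val_mul d3 d4] at h5
  rw [← coe_val d2, WithTop.coe_inj] at h1
  rw [← coe_val d4, WithTop.coe_inj] at h3
  rw [← h1] at h1'
  rw [← h3, val_mul hz hu, val_div hy hy₀, zsmul_add] at h3'
  have h6 : val v (D y) - val v (D y₀) = val v (D (z * (y / y₀))) - val v (D z) := by grind
  rw [h6, nsmul_sub, h1', h3']
  abel

variable [hF : DfnField L K] [hV : DfnVal L v] [hU : UniformBalls L v] [IsAlgClosed K]

-- The predicate whose definability is inferred is a large term.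
set_option synthInstance.maxSize 1000 in
include hF hV hU in
/-- A definable function is constant on some smaller ball, or it has constant slope there. -/
theorem exists_ob_const_or_slope
    (hΓ : ∀ g : Γ → Γ, DefinableGammaFun L v g → EventuallyQLinear g)
    (G : K → K) [DfnF₁ L G] (a : K) {c : K} (hc : c ≠ 0) :
    ∃ a' c', c' ≠ 0 ∧ ob v a' c' ⊆ ob v a c ∧ ((∀ x ∈ ob v a' c', G x = G a') ∨
      ∃ (q : ℕ) (p : ℤ) (κ : Γ), q ≠ 0 ∧ ∀ x ∈ ob v a' c', ∀ y ∈ ob v a' c', x ≠ y →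
        G x - G y ≠ 0 ∧ q • val v (G x - G y) = p • val v (x - y) + κ) := by
  by_cases hconst : ∃ x ∈ ob v a c, ∀ᶠ y in nz v, G (x + y) = G x
  · obtain ⟨x, hx, h⟩ := hconst
    obtain ⟨d, hd, h⟩ := eventually_nz.1 h
    obtain ⟨e, he, hce, hde⟩ := exists_val_max (v := v) hc hd
    refine ⟨x, e, he, ob_subset_ob hx hce, Or.inl fun y hy => ?_⟩
    by_cases hyx : y = x
    · rw [hyx]
    · simpa using h (y - x) (sub_ne_zero.2 hyx) (hde.trans_lt hy)
  have hne : ∀ x ∈ ob v a c, ∀ᶠ y in nz v, G (x + y) - G x ≠ 0 := fun x hx =>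
    ((eventually_or L (v := v) fun y => G (x + y) = G x).resolve_left
      fun h => hconst ⟨x, hx, h⟩).mono
      fun y hy => sub_ne_zero.2 hy
  have hlin := fun x hx => eventually_qlinear (L := L) hΓ (fun y => v (G (x + y) - G x))
    ((hne x hx).mono fun y hy => (AddValuation.ne_top_iff v).2 hy)
  obtain ⟨a₁, c₁, e, hc₁, he, hsub₁, hR⟩ := exists_ob_uniform L (v := v) (fun x e =>
      (∀ y, y ≠ 0 → v e < v y → G (x + y) - G x ≠ 0) ∧
      ∀ y₁ y₂ y₃ y₄, (y₁ ≠ 0 ∧ v e < v y₁) → (y₂ ≠ 0 ∧ v e < v y₂) → (y₃ ≠ 0 ∧ v e < v y₃) →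
        (y₄ ≠ 0 ∧ v e < v y₄) → v (y₁ * y₂) = v (y₃ * y₄) →
        v ((G (x + y₁) - G x) * (G (x + y₂) - G x)) = v ((G (x + y₃) - G x) * (G (x + y₄) - G x)))
    (fun x e e' _ _ hee' h => ⟨fun y hy hy' => h.1 y hy (hee'.trans_lt hy'),
      fun y₁ y₂ y₃ y₄ h1 h2 h3 h4 => h.2 y₁ y₂ y₃ y₄ ⟨h1.1, hee'.trans_lt h1.2⟩
        ⟨h2.1, hee'.trans_lt h2.2⟩ ⟨h3.1, hee'.trans_lt h3.2⟩ ⟨h4.1, hee'.trans_lt h4.2⟩⟩) hc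
    (by
      intro x hx
      obtain ⟨q, p, κ, hq, h⟩ := hlin x hx
      obtain ⟨e, he, h⟩ := eventually_nz.1 (h.and (hne x hx))
      have hval : ∀ y, (y ≠ 0 ∧ v e < v y) → G (x + y) - G x ≠ 0 ∧
          q • val v (G (x + y) - G x) = p • val v y + κ := by
        intro y hy
        obtain ⟨⟨γ, h1, h2⟩, h3⟩ := h y hy.1 hy.2
        rw [← coe_val h3, WithTop.coe_inj] at h1
        exact ⟨h3, h1 ▸ h2⟩
      refine ⟨e, he, fun y hy hy' => (hval y ⟨hy, hy'⟩).1, fun y₁ y₂ y₃ y₄ h1 h2 h3 h4 heq => ?_⟩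
      have g1 := hval y₁ h1
      have g2 := hval y₂ h2
      have g3 := hval y₃ h3
      have g4 := hval y₄ h4
      rw [val_eq_iff (mul_ne_zero h1.1 h2.1) (mul_ne_zero h3.1 h4.1), val_mul h1.1 h2.1,
        val_mul h3.1 h4.1] at heq
      rw [val_eq_iff (mul_ne_zero g1.1 g2.1) (mul_ne_zero g3.1 g4.1), val_mul g1.1 g2.1,
        val_mul g3.1 g4.1]
      apply nsmul_right_injective hq
      beta_reduce
      rw [nsmul_add, g1.2, g2.2, add_add_add_comm, ← zsmul_add, heq, nsmul_add, g3.2, g4.2,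
        add_add_add_comm, ← zsmul_add])
  -- The values of the increments at `y₀` and `y₁` determine the slope, and are made constant.
  obtain ⟨y₀, hy₀, hey₀⟩ := exists_val_gt hV.surj he
  obtain ⟨y₁, hy₁, hy₀₁⟩ := exists_val_gt hV.surj hy₀
  obtain ⟨γ₀, a₂, c₂, hc₂, hsub₂, hγ₀⟩ :=
    exists_ob_val_const L (v := v) (fun x => v (G (x + y₀) - G x)) a₁ hc₁
  obtain ⟨γ₁, a₃, c₃, hc₃, hsub₃, hγ₁⟩ :=
    exists_ob_val_const L (v := v) (fun x => v (G (x + y₁) - G x)) a₂ hc₂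
  have hmem : ∀ x ∈ ob v a₃ c₃, x ∈ ob v a₁ c₁ := fun x hx => hsub₂ (hsub₃ hx)
  have hslope : ∀ x ∈ ob v a₃ c₃, ∃ (q : ℕ) (p : ℤ), q ≠ 0 ∧ ∀ y, y ≠ 0 → v e < v y →
      q • (val v (G (x + y) - G x) - val v (G (x + y₀) - G x)) = p • (val v y - val v y₀) := by
    intro x hx
    obtain ⟨q, p, κ, hq, h⟩ := hlin x (hsub₁ (hmem x hx))
    exact ⟨q, p, hq, exists_slope hV.surj hy₀ hey₀ (hR x (hmem x hx)).1 (hR x (hmem x hx)).2 h⟩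
  have ha₃ := mem_ob_self (v := v) (a := a₃) hc₃
  obtain ⟨q, p, hq, hqp⟩ := hslope a₃ ha₃
  have hval₀ : ∀ x ∈ ob v a₃ c₃, val v (G (x + y₀) - G x) = val v (G (a₃ + y₀) - G a₃) := by
    intro x hx
    rw [val, hγ₀ x (hsub₃ hx), val, hγ₀ a₃ (hsub₃ ha₃)]
  have hval₁ : ∀ x ∈ ob v a₃ c₃, val v (G (x + y₁) - G x) = val v (G (a₃ + y₁) - G a₃) := by
    intro x hx
    rw [val, hγ₁ x hx, val, hγ₁ a₃ ha₃]
  have hw : 0 < val v y₁ - val v y₀ := sub_pos.2 ((val_lt_iff hy₀ hy₁).1 hy₀₁)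
  have hsame : ∀ x ∈ ob v a₃ c₃, ∀ y, y ≠ 0 → v e < v y →
      q • (val v (G (x + y) - G x) - val v (G (a₃ + y₀) - G a₃)) = p • (val v y - val v y₀) := by
    intro x hx y hy hey
    obtain ⟨r, s, hr, h⟩ := hslope x hx
    have h1 := h y₁ hy₁ (hey₀.trans hy₀₁)
    have h2 := hqp y₁ hy₁ (hey₀.trans hy₀₁)
    have h3 := h y hy hey
    rw [hval₀ x hx, hval₁ x hx] at h1
    rw [hval₀ x hx] at h3
    have h4 : (r : ℤ) * p = q * s := by
      apply zsmul_left_cancel_of_pos hw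
      rw [mul_zsmul, mul_zsmul, ← h1, ← h2, natCast_zsmul, natCast_zsmul,
        nsmul_left_comm]
    apply nsmul_right_injective hr
    beta_reduce
    rw [nsmul_left_comm, h3, ← natCast_zsmul, ← natCast_zsmul, ← mul_zsmul, ← mul_zsmul, h4]
  obtain ⟨c₄, hc₄, h34, he4⟩ := exists_val_max (v := v) hc₃ he
  refine ⟨a₃, c₄, hc₄, (ob_subset_ob ha₃ h34).trans (hsub₃.trans (hsub₂.trans hsub₁)), Or.inr
    ⟨q, p, q • val v (G (a₃ + y₀) - G a₃) - p • val v y₀, hq, fun x hx y hy hxy => ?_⟩⟩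
  have hy3 : y ∈ ob v a₃ c₃ := ob_subset_ob ha₃ h34 hy
  have h1 : v e < v (x - y) := he4.trans_lt (sub_mem_of_mem_ob hx hy)
  have h2 := (hR y (hmem y hy3)).1 (x - y) (sub_ne_zero.2 hxy) h1
  have h3 := hsame y hy3 (x - y) (sub_ne_zero.2 hxy) h1
  rw [add_sub_cancel] at h2 h3
  refine ⟨h2, ?_⟩
  rw [nsmul_sub, zsmul_sub] at h3
  grind

include hF hV hU in
/-- A definable function is constant on some smaller ball, or it multiplies all distances there by
a constant factor. -/
theorem exists_ob_const_or_scaling [CharZero K]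
    (hΓ : ∀ g : Γ → Γ, DefinableGammaFun L v g → EventuallyQLinear g)
    (hcomplete : IsDefinablyComplete L v)
    (G : K → K) [DfnF₁ L G] (a : K) {c : K} (hc : c ≠ 0) :
    ∃ a' c', c' ≠ 0 ∧ ob v a' c' ⊆ ob v a c ∧ ((∀ x ∈ ob v a' c', G x = G a') ∨
      ∃ e, e ≠ 0 ∧ ∀ x ∈ ob v a' c', ∀ y ∈ ob v a' c', v (G x - G y) = v (e * (x - y))) := by
  obtain ⟨a', c', hc', hsub, h | ⟨q, p, κ, hq, h⟩⟩ := exists_ob_const_or_slope hΓ G a hc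
  · exact ⟨a', c', hc', hsub, Or.inl h⟩
  obtain rfl := slope_eq_one hΓ hcomplete G a' hc' hq h
  obtain ⟨d, hd, hcd⟩ := exists_val_gt hV.surj hc'
  have hd' : a' + d ∈ ob v a' c' := by simpa [mem_ob] using hcd
  have ha' := mem_ob_self (v := v) (a := a') hc'
  obtain ⟨h1, h2⟩ := h _ hd' a' ha' (by simpa using hd)
  rw [add_sub_cancel_left, natCast_zsmul] at h2
  refine ⟨a', c', hc', hsub, Or.inr ⟨_, div_ne_zero h1 hd, fun x hx y hy => ?_⟩⟩
  by_cases hxy : x = y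
  · simp [hxy]
  obtain ⟨h3, h4⟩ := h x hx y hy hxy
  have h5 := sub_ne_zero.2 hxy
  rw [natCast_zsmul] at h4
  rw [val_eq_iff h3 (mul_ne_zero (div_ne_zero h1 hd) h5), val_mul (div_ne_zero h1 hd) h5,
    val_div h1 hd]
  apply nsmul_right_injective hq
  beta_reduce
  rw [nsmul_add, nsmul_sub, h2, h4]
  abel

end Isometry

/-! ### The Jacobian property -/

section JacobianProperty

open Filter

section RV

variable {K Γ : Type*} [Field K] [AddCommGroup Γ] [LinearOrder Γ] [IsOrderedAddMonoid Γ]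
  {v : AddValuation K (WithTop Γ)}

theorem rv_zero : rv v (0 : K) = 0 := dif_pos rfl

theorem rv_mul (x y : K) : rv v (x * y) = rv v x * rv v y := by
  by_cases hx : x = 0
  · rw [hx, zero_mul, rv_zero, zero_mul]
  by_cases hy : y = 0
  · rw [hy, mul_zero, rv_zero, mul_zero]
  rw [rv, rv, rv, dif_neg hx, dif_neg hy, dif_neg (mul_ne_zero hx hy), Units.mk0_mul]
  rfl

theorem rv_eq_of_lt {x y : K} (hx : x ≠ 0) (h : v x < v (y - x)) : rv v y = rv v x := by
  have hxy := v.map_eq_of_lt_sub h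
  have hy : y ≠ 0 := by
    rintro rfl
    simp at h
  rw [rv, rv, dif_neg hx, dif_neg hy]
  refine congrArg WithZero.coe (QuotientGroup.eq.2 ?_)
  change 0 < v (((Units.mk0 y hy)⁻¹ * Units.mk0 x hx : Kˣ) - 1 : K)
  have h1 : (((Units.mk0 y hy)⁻¹ * Units.mk0 x hx : Kˣ) - 1 : K) * y = -(y - x) := by
    simp only [Units.val_mul, Units.val_inv_eq_inv_val, Units.val_mk0]
    field_simp
    ring
  by_contra! hle
  have h2 : v (-(y - x)) ≤ v y := by
    rw [← h1, v.map_mul]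
    simpa using add_le_add_left hle (v y)
  rw [v.map_neg, hxy] at h2
  exact h.not_ge h2

variable (v) in
/-- A first-order form of the Jacobian property of `g` on the ball around `a` of radius `v c`:
differences of values of `g` have the same class in `RV` as `e` times the differences of the
arguments, the image is the ball it should be, and there are derivatives of class `rv e`. -/
def JacAt (g : K → K) (a c e : K) : Prop :=
  (∀ x ∈ ob v a c, ∀ y ∈ ob v a c, x ≠ y → v (e * (x - y)) < v (g x - g y - e * (x - y))) ∧
  (∀ u ∈ ob v (g a) (c * e), ∃ x ∈ ob v a c, g x = u) ∧
  ∀ x ∈ ob v a c, ∃ d, v e < v (d - e) ∧ VTendsto v (fun t => (g (x + t) - g x) / t) d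

theorem vOpenBall_val {a c : K} (hc : c ≠ 0) : ob v a c = vOpenBall v a (val v c) := by
  ext x
  simp [mem_ob, vOpenBall, coe_val hc]

theorem isOpenVBall_ob {a c : K} (hc : c ≠ 0) : IsOpenVBall v (ob v a c) :=
  Or.inr ⟨a, _, vOpenBall_val hc⟩

theorem VTendsto.hasVDerivOn (hv : Function.Surjective v) {g : K → K} {B : Set K} {d x : K}
    (h : VTendsto v (fun t => (g (x + t) - g x) / t) d) : HasVDerivOn v g B d x := by
  intro γ
  obtain ⟨e, he, heγ⟩ := exists_val_eq hv γ
  obtain ⟨c, hc, h⟩ := eventually_nz.1 (h e he)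
  refine ⟨val v c, fun y _ hyx hy => ?_⟩
  rw [coe_val hc] at hy
  have := h (y - x) (sub_ne_zero.2 hyx) hy
  simpa [heγ] using this

theorem JacAt.hasJacobianProperty (hv : Function.Surjective v) {g : K → K} {a c e : K}
    (hc : c ≠ 0) (he : e ≠ 0) (h : JacAt v g a c e) : HasJacobianProperty v g (ob v a c) := by
  obtain ⟨h1, h2, h3⟩ := h
  choose! g' hg' hd using h3
  have himage : g '' ob v a c = ob v (g a) (c * e) := by
    refine Set.Subset.antisymm ?_ h2
    rintro _ ⟨x, hx, rfl⟩
    by_cases hxa : x = a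
    · exact hxa ▸ mem_ob_self (mul_ne_zero hc he)
    have hxa' := sub_ne_zero.2 hxa
    rw [mem_ob, v.map_eq_of_lt_sub (h1 x hx a (mem_ob_self hc) hxa), mul_comm c,
      val_lt_iff (mul_ne_zero he hc) (mul_ne_zero he hxa'), val_mul he hc, val_mul he hxa']
    rw [mem_ob, val_lt_iff hc hxa'] at hx
    simpa using hx
  refine ⟨isOpenVBall_ob hc, fun x hx y hy hxy => ?_,
    himage ▸ isOpenVBall_ob (mul_ne_zero hc he), g', fun x hx => (hd x hx).hasVDerivOn hv,
    fun x hx h0 => ?_, rv v e, fun x hx => rv_eq_of_lt he (hg' x hx), fun x hx y hy => ?_⟩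
  · by_contra hne
    simpa [hxy, v.map_neg] using h1 x hx y hy hne
  · simpa [h0, v.map_neg] using hg' x hx
  · by_cases hxy : x = y
    · simp [hxy, rv_zero]
    · rw [rv_eq_of_lt (mul_ne_zero he (sub_ne_zero.2 hxy)) (h1 x hx y hy hxy), rv_mul, mul_comm]

theorem JacAt.congr {g h : K → K} {a c e : K} (hc : c ≠ 0) (hgh : ∀ x ∈ ob v a c, g x = h x)
    (hg : JacAt v g a c e) : JacAt v h a c e := by
  obtain ⟨h1, h2, h3⟩ := hg
  refine ⟨fun x hx y hy => ?_, fun u hu => ?_, fun x hx => ?_⟩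
  · rw [← hgh x hx, ← hgh y hy]
    exact h1 x hx y hy
  · rw [← hgh a (mem_ob_self hc)] at hu
    obtain ⟨x, hx, hxu⟩ := h2 u hu
    exact ⟨x, hx, hgh x hx ▸ hxu⟩
  · obtain ⟨d, hd, hlim⟩ := h3 x hx
    refine ⟨d, hd, hlim.congr' ((eventually_lt_val hc).mono fun t ht => ?_)⟩
    have hxt : x + t ∈ ob v a c := lt_val_sub_trans (y := x) (by simpa using ht) hx
    rw [hgh _ hxt, hgh x hx]

end RV

variable {L : FirstOrder.Language} {K Γ : Type*} [L.Structure K] [Field K]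
  [AddCommGroup Γ] [LinearOrder Γ] [IsOrderedAddMonoid Γ] [Nontrivial Γ]
  {v : AddValuation K (WithTop Γ)}

theorem lt_val_of_lt_val_div {e w y : K} (hy : y ≠ 0) (h : v e < v (w / y - e)) :
    v (e * y) < v (w - e * y) := by
  have h1 : w - e * y = (w / y - e) * y := by
    field_simp
  rw [h1, v.map_mul, v.map_mul]
  exact WithTop.add_lt_add_right ((AddValuation.ne_top_iff v).2 hy) h

variable [hF : DfnField L K] [hV : DfnVal L v] [hU : UniformBalls L v] [IsAlgClosed K] [CharZero K]

include hF hV hU in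
/-- A definable function that multiplies distances by a constant has derivatives, and on a smaller
ball these have constant class in `RV`. -/
theorem exists_ob_derivative
    (hΓ : ∀ g : Γ → Γ, DefinableGammaFun L v g → EventuallyQLinear g)
    (hcomplete : IsDefinablyComplete L v) (G : K → K) [DfnF₁ L G] {a c e : K} (hc : c ≠ 0)
    (he : e ≠ 0)
    (hG : ∀ x ∈ ob v a c, ∀ y ∈ ob v a c, v (G x - G y) = v (e * (x - y))) :
    ∃ a' c' e', c' ≠ 0 ∧ e' ≠ 0 ∧ ob v a' c' ⊆ ob v a c ∧ ∀ x ∈ ob v a' c', ∃ d,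
      v e' < v (d - e') ∧ VTendsto v (fun t => (G (x + t) - G x) / t) d := by
  let D : K → K := fun x => vlim v fun t => (G (x + t) - G x) / t
  have hD : ∀ x ∈ ob v a c, VTendsto v (fun t => (G (x + t) - G x) / t) (D x) ∧ D x ≠ 0 ∧
      1 • val v (D x) = val v e := by
    intro x hx
    refine vtendsto_vlim hΓ hcomplete (fun t => (G (x + t) - G x) / t) one_ne_zero
      (eventually_nz.2 ⟨c, hc, fun t ht hct => ?_⟩)
    have h1 : v (G (x + t) - G x) = v (e * t) := by
      have := hG (x + t) (lt_val_sub_trans (y := x) (by simpa using hct) hx) x hx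
      rwa [add_sub_cancel_left] at this
    have h2 : G (x + t) - G x ≠ 0 := by
      rw [← AddValuation.ne_top_iff v, h1, AddValuation.ne_top_iff]
      exact mul_ne_zero he ht
    refine ⟨div_ne_zero h2 ht, ?_⟩
    rw [val_eq_iff h2 (mul_ne_zero he ht), val_mul he ht] at h1
    rw [one_nsmul, val_div h2 ht, h1, add_sub_cancel_right]
  have hDfn : DfnF₁ L D := by
    have : DfnF L fun z : Fin 1 → K => vlim v fun t => (G (z 0 + t) - G (z 0)) / t := inferInstance
    exact ⟨this⟩
  have hDval : ∀ x ∈ ob v a c, v (D x) = v e := fun x hx =>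
    (val_eq_iff (hD x hx).2.1 he).2 (by simpa using (hD x hx).2.2)
  obtain ⟨a', c', hc', hsub, h⟩ := exists_ob_const_or_scaling hΓ hcomplete D a hc
  have ha' := mem_ob_self (v := v) (a := a') hc'
  suffices ∃ c'', c'' ≠ 0 ∧ v c' ≤ v c'' ∧ ∀ x ∈ ob v a' c'', v e < v (D x - D a') by
    obtain ⟨c'', hc'', hle, h⟩ := this
    have hsub' : ob v a' c'' ⊆ ob v a c := (ob_subset_ob ha' hle).trans hsub
    refine ⟨a', c'', D a', hc'', (hD a' (hsub ha')).2.1, hsub', fun x hx => ⟨D x, ?_,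
      (hD x (hsub' hx)).1⟩⟩
    rw [hDval a' (hsub ha')]
    exact h x hx
  rcases h with h | ⟨e₁, he₁, h⟩
  · exact ⟨c', hc', le_rfl, fun x hx => by simpa [h x hx] using val_lt_top he⟩
  · obtain ⟨c'', hc'', h1, h2⟩ := exists_val_max (v := v) hc' (div_ne_zero he he₁)
    refine ⟨c'', hc'', h1, fun x hx => ?_⟩
    rw [h x (ob_subset_ob ha' h1 hx) a' ha', mul_comm]
    exact lt_val_mul (fun _ => h2.trans_lt hx) he

include hF hV hU in
/-- The one-variable case: a definable function is constant on some smaller ball, or it has the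
Jacobian property there. -/
theorem exists_ob_const_or_jacAt
    (hΓ : ∀ g : Γ → Γ, DefinableGammaFun L v g → EventuallyQLinear g)
    (hcomplete : IsDefinablyComplete L v) (G : K → K) [DfnF₁ L G] (a : K) {c : K} (hc : c ≠ 0) :
    ∃ a' c', c' ≠ 0 ∧ ob v a' c' ⊆ ob v a c ∧
      ((∀ x ∈ ob v a' c', G x = G a') ∨ ∃ e, e ≠ 0 ∧ JacAt v G a' c' e) := by
  obtain ⟨a₁, c₁, hc₁, hsub₁, h | ⟨e₁, he₁, h⟩⟩ := exists_ob_const_or_scaling hΓ hcomplete G a hc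
  · exact ⟨a₁, c₁, hc₁, hsub₁, Or.inl h⟩
  obtain ⟨a₂, c₂, e, hc₂, he, hsub₂, hder⟩ := exists_ob_derivative hΓ hcomplete G hc₁ he₁ h
  obtain ⟨a₃, c₃, d₃, hc₃, hd₃, hsub₃, hlin⟩ := exists_ob_uniform L (v := v)
    (fun x d => ∀ y, y ≠ 0 → v d < v y → v (e * y) < v (G (x + y) - G x - e * y))
    (fun x d d' _ _ hdd' h y hy hy' => h y hy (hdd'.trans_lt hy')) hc₂ (by
      intro x hx
      obtain ⟨d, hd, hlim⟩ := hder x hx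
      refine eventually_nz.1 (((hlim e he).and eventually_ne_zero).mono fun y hy => ?_)
      exact lt_val_of_lt_val_div hy.2 (lt_val_sub_trans hy.1 hd))
  obtain ⟨c₄, hc₄, hle, hle'⟩ := exists_val_max (v := v) hc₃ hd₃
  have ha₃ := mem_ob_self (v := v) (a := a₃) hc₃
  have hsub₄ : ob v a₃ c₄ ⊆ ob v a₃ c₃ := ob_subset_ob ha₃ hle
  have hlin₄ : ∀ x ∈ ob v a₃ c₄, ∀ y ∈ ob v a₃ c₄, x ≠ y →
      v (e * (x - y)) < v (G x - G y - e * (x - y)) := by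
    intro x hx y hy hxy
    have := hlin y (hsub₄ hy) (x - y) (sub_ne_zero.2 hxy) (hle'.trans_lt (sub_mem_of_mem_ob hx hy))
    rwa [add_sub_cancel] at this
  have hinj : Set.InjOn G (ob v a₃ c₄) := by
    intro x hx y hy hxy
    by_contra hne
    simpa [hxy, v.map_neg] using hlin₄ x hx y hy hne
  -- The image is infinite, hence contains a ball, whose centre is taken as the value at the centre.
  obtain ⟨b, d, hd, himage⟩ := exists_ob_subset_of_infinite L (v := v)
    (fun u => ∃ x, v c₄ < v (x - a₃) ∧ G x = u) (((ob_infinite hV.surj a₃ hc₄).image hinj).mono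
      (by rintro _ ⟨x, hx, rfl⟩; exact ⟨x, hx, rfl⟩))
  obtain ⟨a₅, ha₅, rfl⟩ := himage b (mem_ob_self hd)
  obtain ⟨c₅, hc₅, h45, hde⟩ := exists_val_max (v := v) hc₄ (div_ne_zero hd he)
  have hsub₅ : ob v a₅ c₅ ⊆ ob v a₃ c₄ := ob_subset_ob ha₅ h45
  refine ⟨a₅, c₅, hc₅, hsub₅.trans (hsub₄.trans (hsub₃.trans (hsub₂.trans hsub₁))), Or.inr
    ⟨e, he, fun x hx y hy => hlin₄ x (hsub₅ hx) y (hsub₅ hy), fun u hu => ?_,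
      fun x hx => hder x (hsub₃ (hsub₄ (hsub₅ hx)))⟩⟩
  have hd' : v d ≤ v (c₅ * e) := by
    rw [val_le_iff (div_ne_zero hd he) hc₅, val_div hd he, sub_le_iff_le_add] at hde
    rwa [val_le_iff hd (mul_ne_zero hc₅ he), val_mul hc₅ he]
  obtain ⟨x, hx, rfl⟩ := himage u (hd'.trans_lt hu)
  refine ⟨x, ?_, rfl⟩
  by_cases hxa : x = a₅
  · exact hxa ▸ mem_ob_self hc₅
  have hxa' := sub_ne_zero.2 hxa
  rw [mem_ob, v.map_eq_of_lt_sub (hlin₄ x hx a₅ ha₅ hxa), mul_comm c₅,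
    val_lt_iff (mul_ne_zero he hc₅) (mul_ne_zero he hxa'), val_mul he hc₅, val_mul he hxa',
    add_lt_add_iff_left] at hu
  rwa [mem_ob, val_lt_iff hc₅ hxa']

end JacobianProperty

/-! ### Families of subsets of the field and of functions -/

section Families

variable (L : FirstOrder.Language) {K Γ : Type*} [L.Structure K] {n : ℕ}

/-- The family `S` of subsets of `K`, parametrized by `K ^ n`, is definable. -/
class DfnFam (S : (Fin n → K) → K → Prop) : Prop where
  out : Dfn L fun z : Fin n ⊕ Fin 1 → K => S (fun i => z (Sum.inl i)) (z (Sum.inr 0))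

/-- The family `g` of functions from `K` to `K`, parametrized by `K ^ n`, is definable. -/
class DfnFunFam (g : (Fin n → K) → K → K) : Prop where
  out : DfnF L fun z : Fin n ⊕ Fin 1 → K => g (fun i => z (Sum.inl i)) (z (Sum.inr 0))

variable {L} {β : Type}

instance DfnFam.comp {S : (Fin n → K) → K → Prop} [hS : DfnFam L S] {j : Fin n → β}
    {g : (β → K) → K} [hg : DfnF L g] : Dfn L fun z => S (fun i => z (j i)) (g z) :=
  Dfn.subst (g := Sum.elim (fun i z => z (j i)) fun _ => g) hS.out (by
    rintro (i | i)
    · exact dfnF_var (j i)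
    · exact hg)

instance DfnFunFam.comp {f : (Fin n → K) → K → K} [hf : DfnFunFam L f] {j : Fin n → β}
    {g : (β → K) → K} [hg : DfnF L g] : DfnF L fun z => f (fun i => z (j i)) (g z) :=
  DfnF.subst (g := Sum.elim (fun i z => z (j i)) fun _ => g) hf.out (by
    rintro (i | i)
    · exact dfnF_var (j i)
    · exact hg)

instance DfnFam.member {S : (Fin n → K) → K → Prop} [hS : DfnFam L S] (w : Fin n → K) :
    Dfn₁ L (S w) :=
  ⟨Dfn.subst (g := Sum.elim (fun i _ => w i) fun _ z => z 0) hS.out (by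
    rintro (i | i)
    · exact dfnF_const (w i)
    · exact dfnF_var 0)⟩

instance DfnFunFam.member {f : (Fin n → K) → K → K} [hf : DfnFunFam L f] (w : Fin n → K) :
    DfnF₁ L (f w) :=
  ⟨DfnF.subst (g := Sum.elim (fun i _ => w i) fun _ z => z 0) hf.out (by
    rintro (i | i)
    · exact dfnF_const (w i)
    · exact dfnF_var 0)⟩

open Classical in
/-- The extension by `0` of a definable family of functions. -/
theorem DefinableFunOn.dfnFunFam [Field K] {X : Set ((Fin n → K) × K)}
    {f : (Fin n → K) → K → K} (hX : DfnFam L fun w x => (w, x) ∈ X) (hf : DefinableFunOn L X f) :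
    DfnFunFam L fun w x => if (w, x) ∈ X then f w x else 0 := by
  have h1 : Dfn L fun z : Option (Fin n ⊕ Fin 1) → K =>
      (fun i => z (some (Sum.inl i)), z (some (Sum.inr 0))) ∈ X ∧
        f (fun i => z (some (Sum.inl i))) (z (some (Sum.inr 0))) = z none :=
    Dfn.comap (P := fun z : Fin n ⊕ Fin 2 → K => (z ∘ Sum.inl, z (Sum.inr 0)) ∈ X ∧
      f (z ∘ Sum.inl) (z (Sum.inr 0)) = z (Sum.inr 1)) ⟨hf⟩
      (Sum.elim (fun i => some (Sum.inl i)) ![some (Sum.inr 0), none])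
  have h2 : Dfn L fun z : Option (Fin n ⊕ Fin 1) → K =>
      (fun i => z (some (Sum.inl i)), z (some (Sum.inr 0))) ∈ X :=
    hX.out.comap some
  have h3 : Dfn L fun z : Option (Fin n ⊕ Fin 1) → K =>
      ((fun i => z (some (Sum.inl i)), z (some (Sum.inr 0))) ∈ X ∧
        f (fun i => z (some (Sum.inl i))) (z (some (Sum.inr 0))) = z none) ∨
      (¬ (fun i => z (some (Sum.inl i)), z (some (Sum.inr 0))) ∈ X ∧ z none = 0) := inferInstance
  refine ⟨⟨h3.congr fun z => ?_⟩⟩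
  split_ifs with h
  · simp [h]
  · simp [h, eq_comm]

variable [Field K] [AddCommGroup Γ] [LinearOrder Γ] [IsOrderedAddMonoid Γ]

/-- `x` lies in a ball contained in `S` on which `g` is constant. -/
def LocConstAt (v : AddValuation K (WithTop Γ)) (S : K → Prop) (g : K → K) (x : K) : Prop :=
  ∃ a c, c ≠ 0 ∧ x ∈ ob v a c ∧ (∀ y ∈ ob v a c, S y) ∧ ∀ y ∈ ob v a c, g y = g a

/-- `x` lies in a ball contained in `S` on which `g` has the Jacobian property. -/
def LocJacAt (v : AddValuation K (WithTop Γ)) (S : K → Prop) (g : K → K) (x : K) : Prop :=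
  ∃ a c e, c ≠ 0 ∧ e ≠ 0 ∧ x ∈ ob v a c ∧ (∀ y ∈ ob v a c, S y) ∧ JacAt v g a c e

variable {v : AddValuation K (WithTop Γ)}

/-- A function with the Jacobian property is injective, and so not locally constant. -/
theorem not_locJacAt_of_locConstAt [Nontrivial Γ] (hv : Function.Surjective v) {S T : K → Prop}
    {g : K → K} {x : K} (h : LocConstAt v S g x) : ¬ LocJacAt v T g x := by
  rintro ⟨a', c', e, hc', he, hx', -, hjac, -, -⟩
  obtain ⟨a, c, hc, hx, -, hconst⟩ := h
  obtain ⟨d, hd, hcd, hcd'⟩ := exists_val_max (v := v) hc hc'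
  obtain ⟨y, hy, hdy⟩ := exists_val_gt hv hd
  have h1 : x + y ∈ ob v a c := lt_val_sub_trans (y := x) (by simpa using hcd.trans_lt hdy) hx
  have h2 : x + y ∈ ob v a' c' := lt_val_sub_trans (y := x) (by simpa using hcd'.trans_lt hdy) hx'
  have h3 := hjac _ h2 x hx' (by simpa using hy)
  rw [hconst _ h1, hconst x hx, sub_self, zero_sub, v.map_neg] at h3
  exact lt_irrefl _ h3

variable [hF : DfnField L K] [hV : DfnVal L v]

include hF hV in
theorem DfnFam.locConstAt {S : (Fin n → K) → K → Prop} [DfnFam L S] {g : (Fin n → K) → K → K}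
    [DfnFunFam L g] : DfnFam L fun w x => LocConstAt v (S w) (g w) x := by
  refine ⟨?_⟩
  simp only [LocConstAt, mem_ob]
  infer_instance

-- The predicate whose definability is inferred is a large term.
set_option synthInstance.maxSize 1000 in
include hF hV in
theorem DfnFam.locJacAt {S : (Fin n → K) → K → Prop} [DfnFam L S] {g : (Fin n → K) → K → K}
    [DfnFunFam L g] : DfnFam L fun w x => LocJacAt v (S w) (g w) x := by
  refine ⟨?_⟩
  simp only [LocJacAt, JacAt, VTendsto, mem_ob]
  infer_instance

variable [hU : UniformBalls L v] [IsAlgClosed K] [CharZero K] [Nontrivial Γ]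

include hF hV hU in
/-- The exceptional set is finite: it is definable, and cannot contain a ball. -/
theorem finite_not_locConstAt_not_locJacAt
    (hΓ : ∀ g : Γ → Γ, DefinableGammaFun L v g → EventuallyQLinear g)
    (hcomplete : IsDefinablyComplete L v) (S : K → Prop) (g : K → K) [DfnF₁ L g]
    (h : Dfn₁ L fun x => S x ∧ ¬ LocConstAt v S g x ∧ ¬ LocJacAt v S g x) :
    {x | S x ∧ ¬ LocConstAt v S g x ∧ ¬ LocJacAt v S g x}.Finite := by
  by_contra hinf
  obtain ⟨a, c, hc, hball⟩ := exists_ob_subset_of_infinite L (v := v)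
    (fun x => S x ∧ ¬ LocConstAt v S g x ∧ ¬ LocJacAt v S g x) hinf
  obtain ⟨a', c', hc', hsub, h⟩ := exists_ob_const_or_jacAt hΓ hcomplete g a hc
  have ha' := mem_ob_self (v := v) (a := a') hc'
  have hS : ∀ y ∈ ob v a' c', S y := fun y hy => (hball y (hsub hy)).1
  rcases h with h | ⟨e, he, h⟩
  · exact (hball a' (hsub ha')).2.1 ⟨a', c', hc', ha', hS, h⟩
  · exact (hball a' (hsub ha')).2.2 ⟨a', c', e, hc', he, ha', hS, h⟩

end Families

theorem mainTheorem9 {K Γ : Type*} [Field K] [CharZero K] [IsAlgClosed K]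
    [AddCommGroup Γ] [LinearOrder Γ] [IsOrderedAddMonoid Γ] [Nontrivial Γ]
    (v : AddValuation K (WithTop Γ)) (hv : Function.Surjective v)
    {L : FirstOrder.Language} [L.Structure K] (ι : divLang →ᴸ L)
    (hι : letI := divStructure v; ι.IsExpansionOn K)
    (hC : IsCMinimal ι K) (hcomplete : IsDefinablyComplete L v)
    (hΓ : ∀ g : Γ → Γ, DefinableGammaFun L v g → EventuallyQLinear g)
    {n : ℕ} (W : Set (Fin n → K)) (X : Set ((Fin n → K) × K)) (hX : IsDefinableFamily L W X)
    (f : (Fin n → K) → K → K) (hf : DefinableFunOn L X f) :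
    ∃ F E J : Set ((Fin n → K) × K),
      DefinableFam L F ∧ DefinableFam L E ∧ DefinableFam L J ∧
      X = F ∪ E ∪ J ∧ Disjoint F E ∧ Disjoint F J ∧ Disjoint E J ∧
      ∀ w ∈ W, (fibre F w).Finite ∧ IsLocallyConstOn v (f w) (fibre E w) ∧
        HasLocallyJacobianProperty v (f w) (fibre J w) := by
  classical
  have := dfnField_of_expansion hι
  have := dfnVal_of_expansion hv hι
  have : UniformBalls L v := ⟨fun P hP => exists_ballDet_family hι hC P hP⟩
  let S : (Fin n → K) → K → Prop := fun w x => (w, x) ∈ X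
  let g : (Fin n → K) → K → K := fun w x => if (w, x) ∈ X then f w x else 0
  have hS : DfnFam L S := ⟨⟨hX.definable_total⟩⟩
  have hg : DfnFunFam L g := DefinableFunOn.dfnFunFam hS hf
  have hgf : ∀ w x, S w x → g w x = f w x := fun w x h => if_pos h
  have hE : DfnFam L fun w x => LocConstAt v (S w) (g w) x := DfnFam.locConstAt
  have hJ : DfnFam L fun w x => LocJacAt v (S w) (g w) x := DfnFam.locJacAt
  have hEX : ∀ w x, LocConstAt v (S w) (g w) x → S w x := fun w x ⟨_, _, _, hx, h, _⟩ => h x hx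
  have hJX : ∀ w x, LocJacAt v (S w) (g w) x → S w x := fun w x ⟨_, _, _, _, _, hx, h, _⟩ => h x hx
  have hF : DfnFam L fun w x =>
      S w x ∧ ¬ LocConstAt v (S w) (g w) x ∧ ¬ LocJacAt v (S w) (g w) x :=
    ⟨@Dfn.and _ _ _ _ _ _ hS.out
      (@Dfn.and _ _ _ _ _ _ (@Dfn.not _ _ _ _ _ hE.out) (@Dfn.not _ _ _ _ _ hJ.out))⟩
  refine ⟨{p | S p.1 p.2 ∧ ¬ LocConstAt v (S p.1) (g p.1) p.2 ∧ ¬ LocJacAt v (S p.1) (g p.1) p.2},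
    {p | LocConstAt v (S p.1) (g p.1) p.2}, {p | LocJacAt v (S p.1) (g p.1) p.2},
    hF.out.out, hE.out.out, hJ.out.out, ?_, ?_, ?_, ?_, fun w _ => ⟨?_, ?_, ?_⟩⟩
  · ext ⟨w, x⟩
    constructor
    · intro h
      by_cases h1 : LocConstAt v (S w) (g w) x
      · exact Or.inl (Or.inr h1)
      by_cases h2 : LocJacAt v (S w) (g w) x
      · exact Or.inr h2
      · exact Or.inl (Or.inl ⟨h, h1, h2⟩)
    · rintro ((h | h) | h)
      exacts [h.1, hEX w x h, hJX w x h]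
  · exact Set.disjoint_left.2 fun p h h' => h.2.1 h'
  · exact Set.disjoint_left.2 fun p h h' => h.2.2 h'
  · exact Set.disjoint_left.2 fun p h => not_locJacAt_of_locConstAt hv h
  · exact finite_not_locConstAt_not_locJacAt hΓ hcomplete (S w) (g w) (hF.member w)
  · rintro x ⟨a, c, hc, hx, hball, hconst⟩
    refine ⟨ob v a c, fun y hy => ⟨a, c, hc, hy, hball, hconst⟩, hx, isOpenVBall_ob hc,
      fun y hy => ?_⟩
    rw [← hgf w y (hball y hy), ← hgf w x (hball x hx), hconst y hy, hconst x hx]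
  · rintro x ⟨a, c, e, hc, he, hx, hball, hjac⟩
    exact ⟨ob v a c, fun y hy => ⟨a, c, e, hc, he, hy, hball, hjac⟩, hx,
      (hjac.congr hc fun y hy => hgf w y (hball y hy)).hasJacobianProperty hv hc he⟩
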